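/- **Setting.** Let $\rho_1,\rho_2,r_1,r_2\in\mathbb R$ and $$\alpha(x)=\frac{(x-\rho_1)(x-\rho_2)}{-2x},\qquad \beta(x)=\frac{(x-r_1+\frac12)(x-r_2+\frac12)}{2x+1},$$ $$H[f](x)=\alpha(x)\,(f(-x)-f(x))+\beta(x)\,(f(-x-1)-f(x)).$$ Put $\lambda_n=\frac n2$ for even $n$ and $\lambda_n=r_1+r_2-\rho_1-\rho_2-\frac{n+1}2$ for odd $n$. The Bannai-Ito polynomial $B_n(x)=B_n(x;\rho_1,\rho_2,r_1,r_2)$ is the monic polynomial of degree $n$ with $H[B_n]=\lambda_nB_n$; it exists and is unique if $\lambda_k\ne\lambda_n$ for all $k<n$. Write $g_r(x)=\Gamma(\frac12+r+x)\Gamma(\frac12+r-x)$, $k_\rho(x)=\Gamma(\rho-x)\Gamma(1+\rho+x)$, $u_i=x+r_i+\frac12$. For $d=1,\dots,8$ the parameters $\sigma_d$, the gauge factor $\xi_d$ and the polynomials $\eta_d,\vartheta_d$ are $$\begin{array}{c|c|c|c|c} d&\sigma_d&\xi_d(x)&\eta_d(x)&\vartheta_d(x)\\\hline 1&(\rho_1,\rho_2,r_1,r_2)&1&1&u_1u_2\\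 2&(-\rho_1,-\rho_2,-r_1,-r_2)&g_{r_1}g_{r_2}/(k_{\rho_1}k_{\rho_2})&(x-\rho_1)(x-\rho_2)&1\\ 3&(-\rho_1,-\rho_2,r_1,r_2)&1/(k_{\rho_1}k_{\rho_2})&(x-\rho_1)(x-\rho_2)&u_1u_2\\ 4&(\rho_1,\rho_2,-r_1,-r_2)&g_{r_1}g_{r_2}&1&1\\ 5&(-\rho_1,\rho_2,-r_1,r_2)&g_{r_1}/k_{\rho_1}&x-\rho_1&u_2\\ 6&(\rho_1,-\rho_2,r_1,-r_2)&g_{r_2}/k_{\rho_2}&x-\rho_2&u_1\\ 7&(\rho_1,-\rho_2,-r_1,r_2)&g_{r_1}/k_{\rho_2}&x-\rho_2&u_2\\ 8&(-\rho_1,\rho_2,r_1,-r_2)&g_{r_2}/k_{\rho_1}&x-\rho_1&u_1 \end{array}$$ For $\mathbf d=(d,m)$ with $m\ge0$ let $p(x)=B_m(x;\sigma_d)$, $\phi=\xi_dp$, and $$\chi(x)=\phi(x)-\phi(-x),\quad \tilde\chi(x)=\beta(-x-1)\phi(x)+\beta(x)\phi(-x-1),\quad r(x)=\tilde\chi(x)\chi(x)\frac{\eta_d(x)}{x\,\xi_d(x)}.$$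 The 1-step exceptional Bannai-Ito polynomial $B^{(1)}_{\mathbf d,n}$ is the polynomial $$B^{(1)}_{\mathbf d,n}(x)=r(x)\Big[\frac{B_n(-x)-B_n(x)}{\chi(x)}+\frac{\beta(x)B_n(-x-1)+\beta(-x-1)B_n(x)}{\tilde\chi(x)}\Big].$$ The exceptional operator $\hat H^{(1)}$ has the coefficients $$\hat\alpha(x)=\frac{r(x)\tilde\chi(-x)}{r(-x)\chi(x)},\qquad \hat\beta(x)=\frac{r(x)\alpha(-x-1)\beta(x)\chi(-x-1)}{r(-x-1)\tilde\chi(x)}$$ at the reflections $f(x)\mapsto f(-x)$ and $f(x)\mapsto f(-x-1)$; removable singularities are removed. A weight function associated with $\hat H^{(1)}$ on a finite set $X\subset\mathbb R$ is a function $\hat\omega^{(1)}$ with $\hat\omega^{(1)}(x)\hat\alpha(x)=\hat\omega^{(1)}(-x)\hat\alpha(-x)$ whenever $x,-x\in X$ and $\hat\omega^{(1)}(x)\hat\beta(x)=\hat\omega^{(1)}(-x-1)\hat\beta(-x-1)$ whenever $x,-x-1\in X$. A weight function of $H$ is a function $\omega$ on $\mathbb R$ with $\omega(x)\alpha(x)=\omega(-x)\alpha(-x)$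 and $\omega(x)\beta(x)=\omega(-x-1)\beta(-x-1)$ off a countable set of $x$. Let $N\ge1$ and $x_s=-\frac14+(-1)^s(\rho_2+\frac s2+\frac14)$. Assume that either $N$ is odd and $r_2=\rho_2+\frac N2$, or $N$ is even and $\rho_1=-\rho_2-\frac N2$. The exceptional Bannai-Ito grid $\chi^{(1)}_{\mathbf d}$ is the following set. For $N$ odd: $$d=1,5:\{x_1,\dots,x_{N-1}\},\quad d=2,6:\{x_0,\dots,x_N\},\quad d=3,7:\{x_0,\dots,x_{N-1}\},\quad d=4,8:\{x_1,\dots,x_N\};$$ for $N$ even: $$d=1,4:\{x_1,\dots,x_{N-2}\},\quad d=2,3:\{x_0,\dots,x_{N-1}\},\quad d=5,8:\{x_1,\dots,x_{N-1}\},\quad d=6,7:\{x_0,\dots,x_{N-2}\}.$$ **Theorem.** Assume that $\lambda_0,\dots,\lambda_{N-1}$ are distinct, that $\lambda_k(\sigma_d)\neq\lambda_m(\sigma_d)$ for $k<m$, and that $\eta_d(x)p(x)\ne\eta_d(-x)p(-x)$ and $\vartheta_d(x)p(x)\neq\vartheta_d(-x-1)p(-x-1)$ for all $x\in\chi^{(1)}_{\mathbf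 d}$. 1. For every weight function $\hat\omega^{(1)}$ associated with $\hat H^{(1)}$ on $\chi^{(1)}_{\mathbf d}$ there are constants $h^{(1)}_{\mathbf d,n}$ with $$\sum_{x\in\chi^{(1)}_{\mathbf d}}\hat\omega^{(1)}(x)\,B^{(1)}_{\mathbf d,n}(x)\,B^{(1)}_{\mathbf d,k}(x)=h^{(1)}_{\mathbf d,n}\,\delta_{nk}\qquad(0\le n,k<N).$$ 2. If $\omega$ is a weight function of $H$ and $c$ satisfies $c(x+1)=c(x)=c(-x)$, then $$\hat\omega^{(1)}(x)=c(x)\frac{\tilde\chi(x)\chi(x)\alpha(x)}{r(x)^2}\,\omega(x)$$ is such a weight function, provided that the right-hand side has a finite limit at every point of the grid (these limits being the values of $\hat\omega^{(1)}$ there). 3. Suppose that $2\rho_2$ and $r_1\pm\rho_2+\frac12$ are not integers and that neither are $\rho_1\pm\rho_2$ (for $N$ odd) or $r_2\pm\rho_2+\frac12$ (for $N$ even). Then $$\omega(x)=\frac{\sin(2\pi x)\,\Gamma(\frac12-r_1+x)\Gamma(\frac12-r_1-x)}{\Gamma(\frac12+r_2+x)\Gamma(\frac12+r_2-x)\Gamma(1-\rho_1+x)\Gamma(-\rho_1-x)\Gamma(1-\rho_2+x)\Gamma(-\rho_2-x)}$$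 is a weight function of $H$, and with $c=1$ the limits in 2 exist and are nonzero at every point of the grid. -/

import Mathlib

open Filter Topology Polynomial

namespace ExcBI

noncomputable section

/-- The four real parameters `ρ₁, ρ₂, r₁, r₂` of the Bannai-Ito operator. -/
structure Params where
  ρ₁ : ℝ
  ρ₂ : ℝ
  r₁ : ℝ
  r₂ : ℝ

/-- The coefficient `α(x) = (x - ρ₁)(x - ρ₂) / (-2x)` of `R - I`. -/
def alpha (P : Params) (x : ℝ) : ℝ := (x - P.ρ₁) * (x - P.ρ₂) / (-2 * x)

/-- The coefficient `β(x) = (x - r₁ + 1/2)(x - r₂ + 1/2) / (2x + 1)` of `TR - I`. -/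
def beta (P : Params) (x : ℝ) : ℝ :=
  (x - P.r₁ + 1 / 2) * (x - P.r₂ + 1 / 2) / (2 * x + 1)

/-- The Bannai-Ito operator `H = α(x)(R - I) + β(x)(TR - I)`, where `R f(x) = f(-x)` and
`TR f(x) = f(-x-1)`. -/
def opH (P : Params) (f : ℝ → ℝ) (x : ℝ) : ℝ :=
  alpha P x * (f (-x) - f x) + beta P x * (f (-x - 1) - f x)

/-- The eigenvalue `λ_n` of the Bannai-Ito polynomial of degree `n`. -/
def eigenvalue (P : Params) (n : ℕ) : ℝ :=
  if Even n then (n : ℝ) / 2 else P.r₁ + P.r₂ - P.ρ₁ - P.ρ₂ - ((n : ℝ) + 1) / 2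

/-- `p` is a monic eigenpolynomial of degree `n` of the Bannai-Ito operator, with eigenvalue `λ_n`
(the points `0` and `-1/2` are the poles of the coefficients of `H`). -/
def IsBannaiIto (P : Params) (n : ℕ) (p : ℝ[X]) : Prop :=
  p.Monic ∧ p.natDegree = n ∧
    ∀ x : ℝ, x ≠ 0 → x ≠ -1 / 2 → opH P (fun y => p.eval y) x = eigenvalue P n * p.eval x

/-- The monic Bannai-Ito polynomial `B_n(x; ρ₁, ρ₂, r₁, r₂)`. It exists and is unique whenever
`λ_k ≠ λ_n` for all `k < n`, because `H` is triangular on the monomials with diagonal `λ_k`. -/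
def bannaiIto (P : Params) (n : ℕ) : ℝ[X] := Classical.epsilon (IsBannaiIto P n)

/-- The index `d ∈ {1, …, 8}` of the eight classes of gauge factors. -/
inductive GaugeClass where
  | d1 | d2 | d3 | d4 | d5 | d6 | d7 | d8

/-- The parameters `σ_d`. -/
def sigma (P : Params) : GaugeClass → Params
  | .d1 => ⟨P.ρ₁, P.ρ₂, P.r₁, P.r₂⟩
  | .d2 => ⟨-P.ρ₁, -P.ρ₂, -P.r₁, -P.r₂⟩
  | .d3 => ⟨-P.ρ₁, -P.ρ₂, P.r₁, P.r₂⟩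
  | .d4 => ⟨P.ρ₁, P.ρ₂, -P.r₁, -P.r₂⟩
  | .d5 => ⟨-P.ρ₁, P.ρ₂, -P.r₁, P.r₂⟩
  | .d6 => ⟨P.ρ₁, -P.ρ₂, P.r₁, -P.r₂⟩
  | .d7 => ⟨P.ρ₁, -P.ρ₂, -P.r₁, P.r₂⟩
  | .d8 => ⟨-P.ρ₁, P.ρ₂, P.r₁, -P.r₂⟩

/-- `Γ(1/2 + r + x) Γ(1/2 + r - x)`. -/
def gammaNum (r x : ℝ) : ℝ := Real.Gamma (1 / 2 + r + x) * Real.Gamma (1 / 2 + r - x)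

/-- `Γ(ρ - x) Γ(1 + ρ + x)`. -/
def gammaDen (ρ x : ℝ) : ℝ := Real.Gamma (ρ - x) * Real.Gamma (1 + ρ + x)

/-- The gauge factors `ξ_d`. -/
def xi (P : Params) (d : GaugeClass) (x : ℝ) : ℝ :=
  match d with
  | .d1 => 1
  | .d2 => gammaNum P.r₁ x * gammaNum P.r₂ x / (gammaDen P.ρ₁ x * gammaDen P.ρ₂ x)
  | .d3 => 1 / (gammaDen P.ρ₁ x * gammaDen P.ρ₂ x)
  | .d4 => gammaNum P.r₁ x * gammaNum P.r₂ x
  | .d5 => gammaNum P.r₁ x / gammaDen P.ρ₁ x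
  | .d6 => gammaNum P.r₂ x / gammaDen P.ρ₂ x
  | .d7 => gammaNum P.r₁ x / gammaDen P.ρ₂ x
  | .d8 => gammaNum P.r₂ x / gammaDen P.ρ₁ x

/-- The polynomial `η_d` of lowest degree with `ξ_d(-x)/ξ_d(x) = η_d(-x)/η_d(x)`. -/
def eta (P : Params) (d : GaugeClass) (x : ℝ) : ℝ :=
  match d with
  | .d1 => 1
  | .d2 => (x - P.ρ₁) * (x - P.ρ₂)
  | .d3 => (x - P.ρ₁) * (x - P.ρ₂)
  | .d4 => 1
  | .d5 => x - P.ρ₁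
  | .d6 => x - P.ρ₂
  | .d7 => x - P.ρ₂
  | .d8 => x - P.ρ₁

/-- The analogue of `η_d` for the reflection `x ↦ -x-1`: the polynomial of lowest degree with
`β(x) ξ_d(-x-1) / (β(-x-1) ξ_d(x)) = - ϑ_d(-x-1)/ϑ_d(x)`. -/
def theta (P : Params) (d : GaugeClass) (x : ℝ) : ℝ :=
  match d with
  | .d1 => (x + P.r₁ + 1 / 2) * (x + P.r₂ + 1 / 2)
  | .d2 => 1
  | .d3 => (x + P.r₁ + 1 / 2) * (x + P.r₂ + 1 / 2)
  | .d4 => 1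
  | .d5 => x + P.r₂ + 1 / 2
  | .d6 => x + P.r₁ + 1 / 2
  | .d7 => x + P.r₂ + 1 / 2
  | .d8 => x + P.r₁ + 1 / 2

/-- The polynomial part `p_m^{(d)}(x) = B_m(x; σ_d)` of the seed solution. -/
def seedPoly (P : Params) (d : GaugeClass) (m : ℕ) (x : ℝ) : ℝ :=
  (bannaiIto (sigma P d) m).eval x

/-- The seed solution `φ(x) = ξ_d(x) p_m^{(d)}(x)`. -/
def seed (P : Params) (d : GaugeClass) (m : ℕ) (x : ℝ) : ℝ := xi P d x * seedPoly P d m x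

/-- `χ(x) = φ(x) - φ(-x)`. -/
def chi (P : Params) (d : GaugeClass) (m : ℕ) (x : ℝ) : ℝ := seed P d m x - seed P d m (-x)

/-- `χ̃(x) = β(-x-1) φ(x) + β(x) φ(-x-1)`. -/
def chiTilde (P : Params) (d : GaugeClass) (m : ℕ) (x : ℝ) : ℝ :=
  beta P (-x - 1) * seed P d m x + beta P x * seed P d m (-x - 1)

/-- The decoupling coefficient `r(x) = χ̃(x) χ(x) η_d(x) / (x ξ_d(x))`. -/
def decoupling (P : Params) (d : GaugeClass) (m : ℕ) (x : ℝ) : ℝ :=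
  chiTilde P d m x * chi P d m x * (eta P d x / (x * xi P d x))

/-- The dressing operator `r(x) [ (1/χ(x)) (R - I) + (1/χ̃(x)) (TR + I) β(-x-1) ]`. -/
def dressing (P : Params) (d : GaugeClass) (m : ℕ) (f : ℝ → ℝ) (x : ℝ) : ℝ :=
  decoupling P d m x *
    (1 / chi P d m x * (f (-x) - f x) +
      1 / chiTilde P d m x * (beta P x * f (-x - 1) + beta P (-x - 1) * f x))

/-- The 1-step exceptional Bannai-Ito polynomial `B^{(1)}_{d,m,n}`: the polynomial that the dressing
operator makes of `B_n`. The Gamma functions in the formula have poles and zeros at isolated points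
(the grid below among them), so the agreement is asked for off a countable set. -/
def xbi (P : Params) (d : GaugeClass) (m n : ℕ) : ℝ[X] :=
  Classical.epsilon fun Q : ℝ[X] => ∃ C : Set ℝ, C.Countable ∧
    ∀ x : ℝ, x ∉ C → Q.eval x = dressing P d m (fun y => (bannaiIto P n).eval y) x

/-- The value at `x` of a function whose singularity at `x` is removable. -/
def removable (f : ℝ → ℝ) (x : ℝ) : ℝ := limUnder (𝓝[≠] x) f

/-- The coefficient of `R` in the normalized exceptional operator `Ĥ^{(1)} = r H^{(1)} r⁻¹`,
`r(x) χ̃(-x) / (r(-x) χ(x))`, with its removable singularities removed. -/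
def alphaHat (P : Params) (d : GaugeClass) (m : ℕ) : ℝ → ℝ :=
  removable fun x => decoupling P d m x * chiTilde P d m (-x) /
    (decoupling P d m (-x) * chi P d m x)

/-- The coefficient of `TR` in the normalized exceptional operator `Ĥ^{(1)} = r H^{(1)} r⁻¹`,
`r(x) α(-x-1) β(x) χ(-x-1) / (r(-x-1) χ̃(x))`, with its removable singularities removed. -/
def betaHat (P : Params) (d : GaugeClass) (m : ℕ) : ℝ → ℝ :=
  removable fun x => decoupling P d m x * alpha P (-x - 1) * beta P x * chi P d m (-x - 1) /
    (decoupling P d m (-x - 1) * chiTilde P d m x)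

/-- `w` is a weight function on `S` associated with a Dunkl shift operator `F R + G TR + C`. -/
def IsWeightOn (S : Set ℝ) (F G w : ℝ → ℝ) : Prop :=
  (∀ x ∈ S, -x ∈ S → w x * F x = w (-x) * F (-x)) ∧
    ∀ x ∈ S, -x - 1 ∈ S → w x * G x = w (-x - 1) * G (-x - 1)

/-- `w` is a weight function of the Bannai-Ito operator: the relations hold at all real `x`, up to
the countably many singularities of `α`, `β` and `w`. -/
def IsBannaiItoWeight (P : Params) (w : ℝ → ℝ) : Prop :=
  ∃ C : Set ℝ, C.Countable ∧ IsWeightOn Cᶜ (alpha P) (beta P) w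

/-- An explicit weight function of the Bannai-Ito operator. -/
def biWeight (P : Params) (x : ℝ) : ℝ :=
  Real.sin (2 * Real.pi * x) * (Real.Gamma (1 / 2 - P.r₁ + x) * Real.Gamma (1 / 2 - P.r₁ - x)) /
    (Real.Gamma (1 / 2 + P.r₂ + x) * Real.Gamma (1 / 2 + P.r₂ - x) *
      (Real.Gamma (1 - P.ρ₁ + x) * Real.Gamma (-P.ρ₁ - x)) *
      (Real.Gamma (1 - P.ρ₂ + x) * Real.Gamma (-P.ρ₂ - x)))

/-- The expression `c(x) χ̃(x) χ(x) α(x) / r(x)² · ω(x)`. -/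
def xbiWeight (P : Params) (d : GaugeClass) (m : ℕ) (c ω : ℝ → ℝ) (x : ℝ) : ℝ :=
  c x * (chiTilde P d m x * chi P d m x * alpha P x / decoupling P d m x ^ 2) * ω x

/-- The Bannai-Ito grid `x_s = -1/4 + (-1)^s (ρ₂ + s/2 + 1/4)`. -/
def gridPoint (P : Params) (s : ℕ) : ℝ :=
  -1 / 4 + (-1) ^ s * (P.ρ₂ + (s : ℝ) / 2 + 1 / 4)

/-- The indices `s` of the points `x_s` of the exceptional Bannai-Ito grid. -/
def gridIndices (N : ℕ) (d : GaugeClass) : Finset ℕ :=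
  if Odd N then
    match d with
    | .d1 | .d5 => Finset.Icc 1 (N - 1)
    | .d2 | .d6 => Finset.Icc 0 N
    | .d3 | .d7 => Finset.Icc 0 (N - 1)
    | .d4 | .d8 => Finset.Icc 1 N
  else
    match d with
    | .d1 | .d4 => Finset.Icc 1 (N - 2)
    | .d2 | .d3 => Finset.Icc 0 (N - 1)
    | .d5 | .d8 => Finset.Icc 1 (N - 1)
    | .d6 | .d7 => Finset.Icc 0 (N - 2)

/-- The exceptional Bannai-Ito grid, as a finite set of real numbers. -/
def grid (P : Params) (N : ℕ) (d : GaugeClass) : Finset ℝ :=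
  (gridIndices N d).image (gridPoint P)

/-- `x` is not an integer. -/
def NotInt (x : ℝ) : Prop := ∀ k : ℤ, x ≠ k

/-- Parameters for which no Gamma factor of the explicit weight degenerates on the grid, apart from
what the truncation condition forces. -/
def Generic (P : Params) (N : ℕ) : Prop :=
  NotInt (2 * P.ρ₂) ∧ NotInt (P.r₁ + P.ρ₂ + 1 / 2) ∧ NotInt (P.r₁ - P.ρ₂ + 1 / 2) ∧
    (Odd N → NotInt (P.ρ₁ + P.ρ₂) ∧ NotInt (P.ρ₁ - P.ρ₂)) ∧
    (Even N → NotInt (P.r₂ + P.ρ₂ + 1 / 2) ∧ NotInt (P.r₂ - P.ρ₂ + 1 / 2))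

end

end ExcBI

open ExcBI

open Filter Topology Polynomial

namespace ExcBI

/-! Write η η* = (x-ρ₁)(x-ρ₂) and ϑ ϑ* = (x+r₁+1/2)(x+r₂+1/2). The functional equation of Γ shows
that ξ/η is invariant under x ↦ -x and ξϑ* under x ↦ -x-1, off a countable set. So ξ factors out of
both reflections: if a, t are the polynomials with x a = ηp - R(ηp) and (2x+1) t = ϑp - TR(ϑp), then
χ = ξ x a/η, χ̃ = -ϑ*ξt and r = -ϑ*ξta. The Gamma factors of the seed therefore cancel: the
coefficients of Ĥ become rational (`alphaHat_formula`, `betaHat_formula`), and B_n is dressed to Q =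
-ϑ*tηD + aS, where x D = B_n(-x) - B_n(x) and S = β(x)B_n(-x-1) + β(-x-1)B_n(x) (`dressing_eq`).

In these terms Hφ = (κ+r₁+r₂)φ and HB_n = λB_n read η*a/2 - ϑ*t = κp and -ηη*D/2 + S = (λ-r₁-r₂)B_n.
Comparing each equation at x with the same equation at -x and at -x-1 eliminates p and B_n
(`exceptional_eigen`): the R part of Ĥ sends Q to λ-κ-r₁-r₂ times its first summand, the TR part to
the same multiple of the second. Hence Q is an eigenfunction, and all eigenvalues are shifted by one
constant, so they stay distinct.

Orthogonality is then the symmetry of a finite weighted operator (`sum_weight_eq_zero`). The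
reflections link the grid points into a chain, and at each end the coefficient of the outgoing
reflection vanishes, by the truncation condition or by the factor x-ρ₂ (`neg_mem_grid_or`,
`neg_sub_one_mem_grid_or`).

The weight relations of part 2 are algebraic identities at regular points and pass to the grid by
limits (`isWeightOn_of_tendsto`). For part 3 the weight equals cη*ω/(2ϑ*at) (`xbiWeight_eq`); the
explicit ω can degenerate on the grid only through Γ(1/2+r₂+x) at x_N, where ϑ* has a compensating
zero. -/

/-! ### Triangularity of H and existence of the Bannai-Ito polynomials -/

theorem alpha_mul (P : Params) {x : ℝ} (hx : x ≠ 0) :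
    alpha P x * x = -((x - P.ρ₁) * (x - P.ρ₂)) / 2 := by
  unfold alpha
  field_simp

theorem beta_mul (P : Params) {x : ℝ} (hx : 2 * x + 1 ≠ 0) :
    beta P x * (2 * x + 1) = (x - P.r₁ + 1 / 2) * (x - P.r₂ + 1 / 2) :=
  div_mul_cancel₀ _ hx

/-- `∑_{j<k} (x+1)^{2j} x^{2(k-1-j)}`, the quotient of `(x+1)^{2k} - x^{2k}` by `2x+1`. -/
noncomputable def powDiffQuot (k : ℕ) : ℝ[X] :=
  ∑ j ∈ Finset.range k, ((X + 1) ^ 2) ^ j * (X ^ 2) ^ (k - 1 - j)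

theorem eval_powDiffQuot (k : ℕ) (x : ℝ) :
    (powDiffQuot k).eval x * (2 * x + 1) = (x + 1) ^ (2 * k) - x ^ (2 * k) := by
  have h := Commute.geom_sum₂_mul (Commute.all ((x + 1) ^ 2) (x ^ 2)) k
  rw [pow_mul, pow_mul, ← h, powDiffQuot, eval_finsetSum]
  simp only [eval_mul, eval_pow, eval_add, eval_X, eval_one]
  ring

/-- Each of the k summands of `powDiffQuot k`, times g, is monic of degree e+2k. This is where the k
in the eigenvalues comes from: e = 0 serves even degrees, e = 1 odd ones. -/
theorem degree_mul_powDiffQuot_sub_lt {g : ℝ[X]} {e : ℕ} (hg : g.Monic) (he : g.natDegree = e + 2)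
    (k : ℕ) : (g * powDiffQuot k - C (k : ℝ) * X ^ (e + 2 * k)).degree <
      ((e + 2 * k : ℕ) : WithBot ℕ) := by
  have hsum : g * powDiffQuot k - C (k : ℝ) * X ^ (e + 2 * k) =
      ∑ j ∈ Finset.range k, (g * (((X + 1) ^ 2) ^ j * (X ^ 2) ^ (k - 1 - j)) - X ^ (e + 2 * k)) := by
    rw [Finset.sum_sub_distrib, powDiffQuot, Finset.mul_sum]
    simp
  rw [hsum]
  refine (Polynomial.degree_sum_le _ _).trans_lt ?_
  rw [Finset.sup_lt_iff (WithBot.bot_lt_coe _)]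
  intro j hj
  have hj' : j < k := Finset.mem_range.mp hj
  have hX1 : (X + 1 : ℝ[X]).Monic := by simpa using monic_X_add_C (1 : ℝ)
  have hX1d : (X + 1 : ℝ[X]).natDegree = 1 := by simpa using natDegree_X_add_C (1 : ℝ)
  have hm1 : (((X + 1 : ℝ[X]) ^ 2) ^ j).Monic := (hX1.pow 2).pow j
  have hm2 : (((X : ℝ[X]) ^ 2) ^ (k - 1 - j)).Monic := (monic_X.pow 2).pow _
  have hm : (g * (((X + 1) ^ 2) ^ j * (X ^ 2) ^ (k - 1 - j))).Monic := hg.mul (hm1.mul hm2)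
  have hd : (g * (((X + 1) ^ 2) ^ j * (X ^ 2) ^ (k - 1 - j))).natDegree = e + 2 * k := by
    rw [hg.natDegree_mul (hm1.mul hm2), hm1.natDegree_mul hm2, he, (hX1.pow 2).natDegree_pow,
      hX1.natDegree_pow, hX1d, ← pow_mul, natDegree_X_pow]
    omega
  have hdeg : (g * (((X + 1) ^ 2) ^ j * (X ^ 2) ^ (k - 1 - j))).degree =
      ((e + 2 * k : ℕ) : WithBot ℕ) := by rw [degree_eq_natDegree hm.ne_zero, hd]
  rw [← hdeg]
  refine degree_sub_lt_left (by rw [hdeg, degree_X_pow]) hm.ne_zero ?_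
  rw [hm.leadingCoeff, leadingCoeff_X_pow]

/-- `H` is triangular on the monomials, with diagonal `λ_n`. -/
theorem opH_monomial (P : Params) (n : ℕ) : ∃ R : ℝ[X], R.degree < n ∧
    ∀ x : ℝ, x ≠ 0 → x ≠ -1 / 2 →
      opH P (fun y => y ^ n) x = eigenvalue P n * x ^ n + R.eval x := by
  set g : ℝ[X] := (X - C (P.r₁ - 1 / 2)) * (X - C (P.r₂ - 1 / 2)) with hg
  have hgm : g.Monic := (monic_X_sub_C _).mul (monic_X_sub_C _)
  have hgd : g.natDegree = 2 := by
    rw [hg, (monic_X_sub_C _).natDegree_mul (monic_X_sub_C _), natDegree_X_sub_C,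
      natDegree_X_sub_C]
  rcases Nat.even_or_odd' n with ⟨k, rfl | rfl⟩
  · refine ⟨g * powDiffQuot k - C (k : ℝ) * X ^ (0 + 2 * k), ?_, ?_⟩
    · simpa using degree_mul_powDiffQuot_sub_lt hgm (e := 0) (by rw [hgd]) k
    · intro x hx hx'
      have h2 : 2 * x + 1 ≠ 0 := fun h => hx' (by linarith)
      have hq := eval_powDiffQuot k x
      have he : (-x) ^ (2 * k) = x ^ (2 * k) := by rw [pow_mul, pow_mul]; simp
      have he' : (-x - 1) ^ (2 * k) = (x + 1) ^ (2 * k) := by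
        rw [pow_mul, pow_mul]; congr 1; ring
      have hl : eigenvalue P (2 * k) = k := by simp [eigenvalue]
      simp only [opH, hl, he, he', ← hq, hg, eval_sub, eval_mul, eval_X, eval_C, eval_pow]
      linear_combination (powDiffQuot k).eval x * beta_mul P h2
  · have hh : ((X + 1) * g : ℝ[X]).Monic := by
      refine Monic.mul ?_ hgm
      simpa using monic_X_add_C (1 : ℝ)
    have hX1d : (X + 1 : ℝ[X]).natDegree = 1 := by simpa using natDegree_X_add_C (1 : ℝ)
    have hhd : ((X + 1) * g : ℝ[X]).natDegree = 1 + 2 := by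
      rw [natDegree_mul (by intro h; simp [h] at hX1d) hgm.ne_zero, hgd, hX1d]
    -- With q = `powDiffQuot k`, (x+1)^(2k+1) + x^(2k+1) = (2x+1)((x+1)q + x^(2k)), so H x^(2k+1) =
    -- x^(2k)((x-ρ₁)(x-ρ₂) - g) - (x+1)gq. The quadratic terms in the bracket cancel, its linear
    -- term goes into the eigenvalue and its constant term is the first summand here.
    refine ⟨C (P.ρ₁ * P.ρ₂ - (P.r₁ - 1 / 2) * (P.r₂ - 1 / 2)) * X ^ (2 * k) -
      ((X + 1) * g * powDiffQuot k - C (k : ℝ) * X ^ (1 + 2 * k)), ?_, ?_⟩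
    · refine (degree_sub_le _ _).trans_lt (max_lt ?_ ?_)
      · refine (degree_C_mul_X_pow_le _ _).trans_lt ?_
        exact_mod_cast Nat.lt_succ_self _
      · simpa [add_comm] using degree_mul_powDiffQuot_sub_lt hh hhd k
    · intro x hx hx'
      have h2 : 2 * x + 1 ≠ 0 := fun h => hx' (by linarith)
      have hq := eval_powDiffQuot k x
      have he : (-x) ^ (2 * k + 1) = -(x * x ^ (2 * k)) := by
        rw [pow_succ, pow_mul, pow_mul]; simp; ring
      have he' : (-x - 1) ^ (2 * k + 1) = -((x + 1) * (x + 1) ^ (2 * k)) := by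
        rw [pow_succ, pow_mul, pow_mul, show (-x - 1) ^ 2 = (x + 1) ^ 2 by ring]; ring
      have hl : eigenvalue P (2 * k + 1) = P.r₁ + P.r₂ - P.ρ₁ - P.ρ₂ - k - 1 := by
        have : ¬ Even (2 * k + 1) := by simp
        simp only [eigenvalue, this, if_false]
        push_cast; ring
      have hq' : (x + 1) ^ (2 * k) = (powDiffQuot k).eval x * (2 * x + 1) + x ^ (2 * k) := by
        rw [hq]; ring
      simp only [opH, hl, he, he', hq', hg, eval_sub, eval_mul, eval_X, eval_C,
        eval_pow, eval_add, eval_one, pow_succ, pow_add]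
      linear_combination -2 * x ^ (2 * k) * alpha_mul P hx -
        ((x + 1) * (powDiffQuot k).eval x + x ^ (2 * k)) * beta_mul P h2

/-- `H - l` maps polynomials of degree `< n` onto polynomials of degree `< n` when `l` is none of
`λ_0, …, λ_{n-1}`. -/
theorem exists_opH_sub_eq (P : Params) (l : ℝ) (n : ℕ) (hl : ∀ k < n, eigenvalue P k ≠ l)
    (g : ℝ[X]) (hg : g.degree < n) : ∃ q : ℝ[X], q.degree < n ∧
      ∀ x : ℝ, x ≠ 0 → x ≠ -1 / 2 →
        opH P (fun y => q.eval y) x - l * q.eval x = g.eval x := by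
  induction n generalizing g with
  | zero =>
    have : g = 0 := by
      rw [← degree_eq_bot]
      simpa [Nat.WithBot.lt_zero_iff] using hg
    exact ⟨0, by simp, by simp [this, opH]⟩
  | succ n ih =>
    obtain ⟨R, hR, hRx⟩ := opH_monomial P n
    have hne : eigenvalue P n - l ≠ 0 := sub_ne_zero.mpr (hl n (Nat.lt_succ_self n))
    -- Chosen so that a xⁿ produces the top coefficient of g; the rest has degree < n and is left to
    -- the induction.
    set a : ℝ := g.coeff n / (eigenvalue P n - l) with ha
    have hdeg : (g - C (g.coeff n) * X ^ n - C a * R).degree < (n : WithBot ℕ) := by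
      refine (degree_sub_le _ _).trans_lt (max_lt ?_ ?_)
      · rw [degree_lt_iff_coeff_zero]
        intro i hi
        rcases hi.eq_or_lt with rfl | hi
        · simp
        · have := (degree_lt_iff_coeff_zero g (n + 1)).mp hg i hi
          simp [this, hi.ne']
      · rw [← smul_eq_C_mul]
        exact (degree_smul_le _ _).trans_lt hR
    obtain ⟨q, hq, hqx⟩ := ih (fun k hk => hl k (Nat.lt_succ_of_lt hk)) _ hdeg
    refine ⟨q + C a * X ^ n, ?_, ?_⟩
    · refine (degree_add_le _ _).trans_lt (max_lt ?_ ?_)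
      · exact hq.trans (by exact_mod_cast Nat.lt_succ_self n)
      · exact (degree_C_mul_X_pow_le _ _).trans_lt (by exact_mod_cast Nat.lt_succ_self n)
    · intro x hx hx'
      have h1 := hqx x hx hx'
      have h2 := hRx x hx hx'
      have h3 : a * (eigenvalue P n - l) = g.coeff n := div_mul_cancel₀ _ hne
      simp only [opH, eval_add, eval_mul, eval_sub, eval_C, eval_pow, eval_X] at h1 h2 ⊢
      linear_combination h1 + a * h2 + x ^ n * h3

theorem exists_isBannaiIto (P : Params) (n : ℕ) (h : ∀ k < n, eigenvalue P k ≠ eigenvalue P n) :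
    ∃ p, IsBannaiIto P n p := by
  obtain ⟨R, hR, hRx⟩ := opH_monomial P n
  obtain ⟨q, hq, hqx⟩ := exists_opH_sub_eq P _ n h R hR
  have hlt : (-q).degree < n := by rwa [degree_neg]
  refine ⟨X ^ n + -q, monic_X_pow_add hlt, ?_, ?_⟩
  · rw [natDegree_eq_of_degree_eq_some]
    rw [degree_add_eq_left_of_degree_lt (by rwa [degree_X_pow]), degree_X_pow]
  · intro x hx hx'
    have h1 := hqx x hx hx'
    have h2 := hRx x hx hx'
    simp only [opH, eval_add, eval_neg, eval_pow, eval_X] at h1 h2 ⊢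
    linear_combination h2 - h1

theorem isBannaiIto_bannaiIto (P : Params) (n : ℕ)
    (h : ∀ k < n, eigenvalue P k ≠ eigenvalue P n) : IsBannaiIto P n (bannaiIto P n) :=
  Classical.epsilon_spec (exists_isBannaiIto P n h)

/-! ### Polynomial quotients of the seed and of B_n, and the eigenvalue equations in terms of them
-/

theorem eq_of_eval_eq_off_countable {p q : ℝ[X]} {s : Set ℝ} (hs : s.Countable)
    (h : ∀ x, x ∉ s → p.eval x = q.eval x) : p = q := by
  refine Polynomial.eq_of_infinite_eval_eq p q ?_
  refine Set.Infinite.mono (s := sᶜ) (fun x hx => h x hx) ?_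
  intro hfin
  have : (Set.univ : Set ℝ).Countable := by
    rw [← Set.union_compl_self s]
    exact hs.union hfin.countable
  exact Set.not_countable_univ this

/-- An odd polynomial is `x` times an even one. -/
theorem exists_even_quotient (q : ℝ[X]) (h : ∀ x, q.eval (-x) = -q.eval x) :
    ∃ a : ℝ[X], (∀ x, q.eval x = x * a.eval x) ∧ ∀ x, a.eval (-x) = a.eval x := by
  have h0 : q.IsRoot 0 := by
    have := h 0
    rw [neg_zero] at this
    rw [IsRoot.def]; linarith
  obtain ⟨a, rfl⟩ := dvd_iff_isRoot.mpr h0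
  refine ⟨a, fun x => by simp, ?_⟩
  have : a.comp (-X) = a := by
    refine eq_of_eval_eq_off_countable (Set.countable_singleton 0) fun x hx => ?_
    have hx0 : x ≠ 0 := hx
    have := h x
    simp only [map_zero, sub_zero, eval_mul, eval_X] at this
    simp only [eval_comp, eval_neg, eval_X]
    exact mul_left_cancel₀ hx0 (by linarith)
  intro x
  have := congrArg (eval x) this
  simpa [eval_comp] using this

/-- A polynomial antisymmetric under `x ↦ -x-1` is `2x+1` times a symmetric one. -/
theorem exists_symm_quotient (q : ℝ[X]) (h : ∀ x, q.eval (-x - 1) = -q.eval x) :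
    ∃ t : ℝ[X], (∀ x, q.eval x = (2 * x + 1) * t.eval x) ∧
      ∀ x, t.eval (-x - 1) = t.eval x := by
  -- The shift x ↦ x - 1/2 conjugates the reflection x ↦ -x-1 to x ↦ -x.
  obtain ⟨a, ha, ha'⟩ := exists_even_quotient (q.comp (X - C (1 / 2))) fun x => by
    have := h (x - 1 / 2)
    simp only [eval_comp, eval_sub, eval_X, eval_C]
    rw [← this]; congr 1; ring
  refine ⟨C (1 / 2) * a.comp (X + C (1 / 2)), fun x => ?_, fun x => ?_⟩
  · have := ha (x + 1 / 2)
    simp only [eval_comp, eval_sub, eval_X, eval_C, eval_add, eval_mul, add_sub_cancel_right]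
      at this ⊢
    rw [this]; ring
  · have := ha' (x + 1 / 2)
    simp only [eval_comp, eval_X, eval_C, eval_add, eval_mul]
    rw [← this]; congr 2; ring

/-- The complementary factor `(x - ρ₁)(x - ρ₂) / η_d(x)`. -/
noncomputable def etaStar (P : Params) (d : GaugeClass) (x : ℝ) : ℝ :=
  match d with
  | .d1 => (x - P.ρ₁) * (x - P.ρ₂)
  | .d2 => 1
  | .d3 => 1
  | .d4 => (x - P.ρ₁) * (x - P.ρ₂)
  | .d5 => x - P.ρ₂
  | .d6 => x - P.ρ₁
  | .d7 => x - P.ρ₁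
  | .d8 => x - P.ρ₂

/-- The complementary factor `(x + r₁ + 1/2)(x + r₂ + 1/2) / ϑ_d(x)`. -/
noncomputable def thetaStar (P : Params) (d : GaugeClass) (x : ℝ) : ℝ :=
  match d with
  | .d1 => 1
  | .d2 => (x + P.r₁ + 1 / 2) * (x + P.r₂ + 1 / 2)
  | .d3 => 1
  | .d4 => (x + P.r₁ + 1 / 2) * (x + P.r₂ + 1 / 2)
  | .d5 => x + P.r₁ + 1 / 2
  | .d6 => x + P.r₂ + 1 / 2
  | .d7 => x + P.r₁ + 1 / 2
  | .d8 => x + P.r₂ + 1 / 2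

theorem eta_mul_etaStar (P : Params) (d : GaugeClass) (x : ℝ) :
    eta P d x * etaStar P d x = (x - P.ρ₁) * (x - P.ρ₂) := by
  cases d <;> simp only [eta, etaStar] <;> ring

theorem theta_mul_thetaStar (P : Params) (d : GaugeClass) (x : ℝ) :
    theta P d x * thetaStar P d x = (x + P.r₁ + 1 / 2) * (x + P.r₂ + 1 / 2) := by
  cases d <;> simp only [theta, thetaStar] <;> ring

theorem exists_eta_poly (P : Params) (d : GaugeClass) :
    ∃ q : ℝ[X], ∀ x, q.eval x = eta P d x := by
  cases d
  case d1 | d4 => exact ⟨1, fun x => by simp [eta]⟩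
  case d2 | d3 => exact ⟨(X - C P.ρ₁) * (X - C P.ρ₂), fun x => by simp [eta]⟩
  case d5 | d8 => exact ⟨X - C P.ρ₁, fun x => by simp [eta]⟩
  case d6 | d7 => exact ⟨X - C P.ρ₂, fun x => by simp [eta]⟩

theorem exists_etaStar_poly (P : Params) (d : GaugeClass) :
    ∃ q : ℝ[X], ∀ x, q.eval x = etaStar P d x := by
  cases d
  case d2 | d3 => exact ⟨1, fun x => by simp [etaStar]⟩
  case d1 | d4 => exact ⟨(X - C P.ρ₁) * (X - C P.ρ₂), fun x => by simp [etaStar]⟩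
  case d6 | d7 => exact ⟨X - C P.ρ₁, fun x => by simp [etaStar]⟩
  case d5 | d8 => exact ⟨X - C P.ρ₂, fun x => by simp [etaStar]⟩

theorem exists_theta_poly (P : Params) (d : GaugeClass) :
    ∃ q : ℝ[X], ∀ x, q.eval x = theta P d x := by
  cases d
  case d2 | d4 => exact ⟨1, fun x => by simp [theta]⟩
  case d1 | d3 =>
    exact ⟨(X + C P.r₁ + C (1 / 2)) * (X + C P.r₂ + C (1 / 2)), fun x => by simp [theta]⟩
  case d6 | d8 => exact ⟨X + C P.r₁ + C (1 / 2), fun x => by simp [theta]⟩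
  case d5 | d7 => exact ⟨X + C P.r₂ + C (1 / 2), fun x => by simp [theta]⟩

theorem exists_thetaStar_poly (P : Params) (d : GaugeClass) :
    ∃ q : ℝ[X], ∀ x, q.eval x = thetaStar P d x := by
  cases d
  case d1 | d3 => exact ⟨1, fun x => by simp [thetaStar]⟩
  case d2 | d4 =>
    exact ⟨(X + C P.r₁ + C (1 / 2)) * (X + C P.r₂ + C (1 / 2)), fun x => by simp [thetaStar]⟩
  case d5 | d7 => exact ⟨X + C P.r₁ + C (1 / 2), fun x => by simp [thetaStar]⟩
  case d6 | d8 => exact ⟨X + C P.r₂ + C (1 / 2), fun x => by simp [thetaStar]⟩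

/-- The polynomial quotients `a(x) = (η_d p - R[η_d p])(x) / x` and
`t(x) = (ϑ_d p - TR[ϑ_d p])(x) / (2x+1)` of a polynomial `p`. -/
structure IsSeedQuotient (P : Params) (d : GaugeClass) (p a t : ℝ → ℝ) : Prop where
  a_eq : ∀ x, eta P d x * p x - eta P d (-x) * p (-x) = x * a x
  a_even : ∀ x, a (-x) = a x
  t_eq : ∀ x, theta P d x * p x - theta P d (-x - 1) * p (-x - 1) = (2 * x + 1) * t x
  t_symm : ∀ x, t (-x - 1) = t x

theorem exists_isSeedQuotient (P : Params) (d : GaugeClass) (p : ℝ[X]) :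
    ∃ a t : ℝ[X], IsSeedQuotient P d (fun x => p.eval x) (fun x => a.eval x)
      (fun x => t.eval x) := by
  obtain ⟨e, he⟩ := exists_eta_poly P d
  obtain ⟨v, hv⟩ := exists_theta_poly P d
  obtain ⟨a, ha, ha'⟩ := exists_even_quotient (e * p - (e * p).comp (-X)) fun x => by
    simp [eval_comp]
  obtain ⟨t, ht, ht'⟩ := exists_symm_quotient (v * p - (v * p).comp (-X - 1)) fun x => by
    simp [eval_comp]
  refine ⟨a, t, fun x => ?_, ha', fun x => ?_, ht'⟩
  · simpa [eval_comp, he] using ha x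
  · simpa [eval_comp, hv] using ht x

/-- The difference quotients `D(x) = (f(-x) - f(x)) / x` and
`S(x) = β(x) f(-x-1) + β(-x-1) f(x)` of a polynomial `f`. -/
structure IsDressQuotient (P : Params) (f D S : ℝ → ℝ) : Prop where
  D_eq : ∀ x, f (-x) - f x = x * D x
  D_even : ∀ x, D (-x) = D x
  S_eq : ∀ x, (x - P.r₁ + 1 / 2) * (x - P.r₂ + 1 / 2) * f (-x - 1) -
    (x + P.r₁ + 1 / 2) * (x + P.r₂ + 1 / 2) * f x = (2 * x + 1) * S x
  S_symm : ∀ x, S (-x - 1) = S x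

theorem exists_isDressQuotient (P : Params) (f : ℝ[X]) :
    ∃ D S : ℝ[X], IsDressQuotient P (fun x => f.eval x) (fun x => D.eval x)
      (fun x => S.eval x) := by
  obtain ⟨D, hD, hD'⟩ := exists_even_quotient (f.comp (-X) - f) fun x => by simp [eval_comp]
  obtain ⟨S, hS, hS'⟩ := exists_symm_quotient
    ((X - C P.r₁ + C (1 / 2)) * (X - C P.r₂ + C (1 / 2)) * f.comp (-X - 1) -
      (X + C P.r₁ + C (1 / 2)) * (X + C P.r₂ + C (1 / 2)) * f) fun x => by
    have : -(-x - 1) - 1 = x := by ring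
    simp only [eval_sub, eval_mul, eval_add, eval_X, eval_C, eval_comp, eval_neg, eval_one, this]
    ring
  refine ⟨D, S, fun x => ?_, hD', fun x => ?_, hS'⟩
  · simpa [eval_comp] using hD x
  · simpa [eval_comp] using hS x

/-- The Bannai-Ito equation in terms of the difference quotients. -/
theorem IsDressQuotient.eigen {P : Params} {n : ℕ} {f D S : ℝ[X]} (hf : IsBannaiIto P n f)
    (h : IsDressQuotient P (fun x => f.eval x) (fun x => D.eval x) (fun x => S.eval x)) (x : ℝ) :
    -((x - P.ρ₁) * (x - P.ρ₂) * D.eval x) / 2 + S.eval x =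
      (eigenvalue P n - P.r₁ - P.r₂) * f.eval x := by
  -- As an identity of polynomials the equation also holds at the poles 0 and -1/2, where the
  -- eigenvalue equation of H is not assumed.
  have key : C (-1 / 2) * ((X - C P.ρ₁) * (X - C P.ρ₂) * D) + S =
      C (eigenvalue P n - P.r₁ - P.r₂) * f := by
    refine eq_of_eval_eq_off_countable (s := {0, -1 / 2})
      ((Set.countable_singleton _).insert _) fun y hy => ?_
    simp only [Set.mem_insert_iff, Set.mem_singleton_iff, not_or] at hy
    have h2 : 2 * y + 1 ≠ 0 := fun h => hy.2 (by linarith)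
    have h2' : y * 2 + 1 ≠ 0 := fun h => hy.2 (by linarith)
    have h1 := hf.2.2 y hy.1 hy.2
    have hD := h.D_eq y
    have hS := h.S_eq y
    simp only [opH, alpha, beta] at h1 hD hS
    simp only [eval_add, eval_mul, eval_sub, eval_X, eval_C]
    have hy0 := hy.1
    rw [hD] at h1
    have : S.eval y = ((y - P.r₁ + 1 / 2) * (y - P.r₂ + 1 / 2) * f.eval (-y - 1) -
      (y + P.r₁ + 1 / 2) * (y + P.r₂ + 1 / 2) * f.eval y) / (2 * y + 1) := by
      rw [hS]; field_simp
    rw [this]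
    field_simp at h1 ⊢
    linear_combination h1
  have := congrArg (eval x) key
  simp only [eval_add, eval_mul, eval_sub, eval_X, eval_C] at this
  linear_combination this

/-- The seed equation in terms of the polynomial quotients. -/
theorem exists_seed_eigen (P : Params) (d : GaugeClass) (m : ℕ) {p a t : ℝ[X]}
    (hp : IsBannaiIto (sigma P d) m p)
    (h : IsSeedQuotient P d (fun x => p.eval x) (fun x => a.eval x) (fun x => t.eval x)) :
    ∃ κ : ℝ, ∀ x, etaStar P d x * a.eval x / 2 - thetaStar P d x * t.eval x = κ * p.eval x := by
  obtain ⟨es, hes⟩ := exists_etaStar_poly P d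
  obtain ⟨vs, hvs⟩ := exists_thetaStar_poly P d
  suffices hκ : ∃ κ : ℝ, ∀ x, x ≠ 0 → x ≠ -1 / 2 →
      etaStar P d x * a.eval x / 2 - thetaStar P d x * t.eval x = κ * p.eval x by
    obtain ⟨κ, hκ⟩ := hκ
    refine ⟨κ, fun x => ?_⟩
    have key : C (1 / 2) * (es * a) - vs * t = C κ * p := by
      refine eq_of_eval_eq_off_countable (s := {0, -1 / 2})
        ((Set.countable_singleton _).insert _) fun y hy => ?_
      simp only [Set.mem_insert_iff, Set.mem_singleton_iff, not_or] at hy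
      have := hκ y hy.1 hy.2
      simp only [eval_mul, eval_sub, eval_C, hes, hvs]
      linear_combination this
    have := congrArg (eval x) key
    simp only [eval_mul, eval_sub, eval_C, hes, hvs] at this
    linear_combination this
  have ha : ∀ x, x ≠ 0 → a.eval x =
      (eta P d x * p.eval x - eta P d (-x) * p.eval (-x)) / x := fun x hx => by
    rw [h.a_eq x]; field_simp
  have ht : ∀ x, 2 * x + 1 ≠ 0 → t.eval x =
      (theta P d x * p.eval x - theta P d (-x - 1) * p.eval (-x - 1)) / (2 * x + 1) :=
    fun x hx => by rw [h.t_eq x]; field_simp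
  set μ := eigenvalue (sigma P d) m with hμ
  -- The left side is H(σ_d)p for `d1`–`d4` and -H(σ_d)p for `d5`–`d8`, plus a constant multiple of
  -- p; κ collects ±μ and that constant. In every class κ + r₁ + r₂ is the eigenvalue of φ under H.
  refine ⟨match d with
    | .d1 => μ - P.r₁ - P.r₂
    | .d2 => μ - P.ρ₁ - P.ρ₂
    | .d3 => μ - P.ρ₁ - P.ρ₂ - P.r₁ - P.r₂
    | .d4 => μ
    | .d5 => -μ - 1 / 2 - P.ρ₂ - P.r₁
    | .d6 => -μ - 1 / 2 - P.ρ₁ - P.r₂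
    | .d7 => -μ - 1 / 2 - P.ρ₁ - P.r₁
    | .d8 => -μ - 1 / 2 - P.ρ₂ - P.r₂, fun x hx hx' => ?_⟩
  have h2 : 2 * x + 1 ≠ 0 := fun h => hx' (by linarith)
  have h2' : x * 2 + 1 ≠ 0 := fun h => hx' (by linarith)
  have h1 := hp.2.2 x hx hx'
  rw [← hμ] at h1
  clear_value μ
  rw [ha x hx, ht x h2]
  cases d <;>
  · simp only [opH, alpha, beta, sigma, eta, etaStar, theta, thetaStar] at h1 ⊢
    field_simp at h1 ⊢
    first
    | linear_combination h1
    | linear_combination -h1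

/-! ### Eigenvalue equation of the exceptional operator -/

/-- The dressed function is an eigenfunction of the exceptional operator (with denominators
`x a(x)` and `2 (2x+1) t(x)`). -/
theorem exceptional_eigen {P : Params} {d : GaugeClass} {p a t f D S : ℝ → ℝ} {κ l : ℝ}
    (hq : IsSeedQuotient P d p a t) (hd : IsDressQuotient P f D S)
    (hp : ∀ x, etaStar P d x * a x / 2 - thetaStar P d x * t x = κ * p x)
    (hf : ∀ x, -((x - P.ρ₁) * (x - P.ρ₂) * D x) / 2 + S x = (l - P.r₁ - P.r₂) * f x)
    {Q : ℝ → ℝ} (hQ : ∀ x, Q x = -(thetaStar P d x * t x * eta P d x * D x) + a x * S x)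
    {x : ℝ} (hx : x ≠ 0) (h2 : 2 * x + 1 ≠ 0) (ha : a x ≠ 0) (ht : t x ≠ 0) :
    -(eta P d x * thetaStar P d x * t x) / (x * a x) * Q (-x) +
      a x * etaStar P d (-x - 1) * theta P d (-x - 1) / (2 * (2 * x + 1) * t x) * Q (-x - 1) -
      (-(eta P d x * thetaStar P d x * t x) / (x * a x) +
        theta P d x * etaStar P d x * a x / (2 * (2 * x + 1) * t x)) * Q x =
      (l - (κ + P.r₁ + P.r₂)) * Q x := by
  have E1 := eta_mul_etaStar P d x
  have E2 := eta_mul_etaStar P d (-x)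
  have E3 := eta_mul_etaStar P d (-x - 1)
  have V1 := theta_mul_thetaStar P d x
  have V3 := theta_mul_thetaStar P d (-x - 1)
  -- the reflections of `η ϑ* t` and of `ϑ η* a`
  have R1 : eta P d (-x) * thetaStar P d (-x) * t (-x) =
      eta P d x * thetaStar P d x * t x + (κ + P.ρ₁ + P.ρ₂) * (x * a x) := by
    have s1 := hp x
    have s2 := hp (-x)
    have s3 := hq.a_eq x
    rw [hq.a_even] at s2
    linear_combination eta P d x * s1 - eta P d (-x) * s2 + κ * s3 - a x / 2 * E1 +
      a x / 2 * E2
  have R2 : theta P d (-x - 1) * etaStar P d (-x - 1) * a (-x - 1) =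
      theta P d x * etaStar P d x * a x -
        2 * (2 * x + 1) * (κ + P.r₁ + P.r₂) * t x := by
    have s1 := hp x
    have s2 := hp (-x - 1)
    have s3 := hq.t_eq x
    rw [hq.t_symm] at s2
    linear_combination -2 * theta P d x * s1 + 2 * theta P d (-x - 1) * s2 - 2 * κ * s3 -
      2 * t x * V1 + 2 * t x * V3
  have F1 : S (-x) = S x + (l - P.r₁ - P.r₂ + P.ρ₁ + P.ρ₂) * (x * D x) := by
    have s1 := hf x
    have s2 := hf (-x)
    have s3 := hd.D_eq x
    rw [hd.D_even] at s2
    linear_combination s2 - s1 + (l - P.r₁ - P.r₂) * s3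
  have F2 : (x - P.r₁ + 1 / 2) * (x - P.r₂ + 1 / 2) * ((-x - 1 - P.ρ₁) * (-x - 1 - P.ρ₂)) *
      D (-x - 1) = (x + P.r₁ + 1 / 2) * (x + P.r₂ + 1 / 2) * ((x - P.ρ₁) * (x - P.ρ₂)) * D x -
        2 * (2 * x + 1) * l * S x := by
    have s1 := hf x
    have s2 := hf (-x - 1)
    have s3 := hd.S_eq x
    rw [hd.S_symm] at s2
    linear_combination -2 * (x - P.r₁ + 1 / 2) * (x - P.r₂ + 1 / 2) * s2 +
      2 * (x + P.r₁ + 1 / 2) * (x + P.r₂ + 1 / 2) * s1 - 2 * (l - P.r₁ - P.r₂) * s3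
  -- Multiplied by the coefficient -ηϑ*t/(xa), the difference Q(-x) - Q(x) gives the first summand
  -- of Q times the shifted eigenvalue; `Q2` supplies the second summand a S.
  have Q1 : Q (-x) = Q x + (l - (κ + P.r₁ + P.r₂)) * (x * a x) * D x := by
    rw [hQ, hQ, hq.a_even, hd.D_even, F1]
    linear_combination -D x * R1
  have Q2 : a x * (etaStar P d (-x - 1) * theta P d (-x - 1) * Q (-x - 1)) =
      (l - (κ + P.r₁ + P.r₂)) * (2 * (2 * x + 1) * t x) * (a x * S x) +
        theta P d x * etaStar P d x * a x * Q x := by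
    rw [hQ, hQ, hq.t_symm, hd.S_symm]
    have e : etaStar P d (-x - 1) * theta P d (-x - 1) *
        (-(thetaStar P d (-x - 1) * t x * eta P d (-x - 1) * D (-x - 1)) + a (-x - 1) * S x) =
        -(t x * ((x - P.r₁ + 1 / 2) * (x - P.r₂ + 1 / 2) *
          ((-x - 1 - P.ρ₁) * (-x - 1 - P.ρ₂)) * D (-x - 1))) +
        (theta P d (-x - 1) * etaStar P d (-x - 1) * a (-x - 1)) * S x := by
      linear_combination -(t x * D (-x - 1) * eta P d (-x - 1) * etaStar P d (-x - 1)) * V3 -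
        (t x * D (-x - 1) * (x - P.r₁ + 1 / 2) * (x - P.r₂ + 1 / 2)) * E3
    rw [e, F2, R2]
    linear_combination a x * t x * D x * eta P d x * etaStar P d x * V1 +
      a x * t x * D x * (x + P.r₁ + 1 / 2) * (x + P.r₂ + 1 / 2) * E1
  have hQx := hQ x
  rw [Q1]
  generalize eta P d x = e at *
  have Q2' : a x * etaStar P d (-x - 1) * theta P d (-x - 1) / (2 * (2 * x + 1) * t x) *
      Q (-x - 1) = (l - (κ + P.r₁ + P.r₂)) * (a x * S x) +
        theta P d x * etaStar P d x * a x / (2 * (2 * x + 1) * t x) * Q x := by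
    have h2' : x * 2 + 1 ≠ 0 := by rwa [mul_comm]
    field_simp
    refine mul_left_cancel₀ ha ?_
    linear_combination Q2
  rw [Q2', hQx]
  field_simp
  ring

/-! ### Regular points, where no Gamma factor degenerates -/

theorem NotInt.neg {x : ℝ} (h : NotInt x) : NotInt (-x) := fun k hk =>
  h (-k) (by push_cast; linarith)

theorem NotInt.of_eq_add {x y : ℝ} (h : NotInt x) (n : ℤ) (hy : y = x + n) : NotInt y :=
  fun k hk => h (k - n) (by push_cast; linarith)

theorem NotInt.of_eq_neg_add {x y : ℝ} (h : NotInt x) (n : ℤ) (hy : y = -x + n) : NotInt y :=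
  h.neg.of_eq_add n hy

theorem NotInt.ne_zero {x : ℝ} (h : NotInt x) : x ≠ 0 := by simpa using h 0

theorem NotInt.gamma_ne_zero {x : ℝ} (h : NotInt x) : Real.Gamma x ≠ 0 :=
  Real.Gamma_ne_zero fun m => by simpa using h (-m)

theorem eventually_notInt (x : ℝ) : ∀ᶠ y in 𝓝[≠] x, NotInt y := by
  rw [← Set.Iio_union_Ioi, nhdsWithin_union, eventually_sup]
  constructor
  · filter_upwards [Ioo_mem_nhdsLT (show ((⌈x⌉ - 1 : ℤ) : ℝ) < x by
      have := Int.ceil_lt_add_one x; push_cast; linarith)] with y hy k hk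
    rw [hk, Set.mem_Ioo] at hy
    have h1 : ⌈x⌉ - 1 < k := by exact_mod_cast hy.1
    have h2 : k < ⌈x⌉ := Int.lt_ceil.mpr hy.2
    omega
  · filter_upwards [Ioo_mem_nhdsGT (show x < ((⌊x⌋ + 1 : ℤ) : ℝ) by
      push_cast; exact Int.lt_floor_add_one x)] with y hy k hk
    rw [hk, Set.mem_Ioo] at hy
    have h1 : k < ⌊x⌋ + 1 := by exact_mod_cast hy.2
    have h2 : ⌊x⌋ < k := Int.floor_lt.mpr hy.1
    omega

theorem eventually_notInt_affine {a : ℝ} (ha : a ≠ 0) (b x : ℝ) :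
    ∀ᶠ y in 𝓝[≠] x, NotInt (a * y + b) := by
  have hc : Tendsto (fun y => a * y + b) (𝓝[≠] x) (𝓝[≠] (a * x + b)) := by
    refine tendsto_nhdsWithin_of_tendsto_nhds_of_eventually_within _ ?_ ?_
    · exact ((continuous_const.mul continuous_id).add continuous_const).continuousAt.tendsto.mono_left
        nhdsWithin_le_nhds
    · filter_upwards [self_mem_nhdsWithin] with y hy h
      exact hy (mul_left_cancel₀ ha (add_right_cancel h))
  exact hc.eventually (eventually_notInt _)

theorem countable_not_notInt_affine {a : ℝ} (ha : a ≠ 0) (b : ℝ) :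
    {y : ℝ | ¬ NotInt (a * y + b)}.Countable := by
  refine (Set.countable_range fun k : ℤ => ((k : ℝ) - b) / a).mono fun y hy => ?_
  simp only [NotInt, ne_eq, not_forall, not_not, Set.mem_ofPred_eq] at hy
  obtain ⟨k, hk⟩ := hy
  exact ⟨k, by simp only [← hk]; field_simp; ring⟩

/-- The points at which no Gamma factor has an integer argument and no coefficient has a pole. -/
structure IsRegular (P : Params) (x : ℝ) : Prop where
  two_mul : NotInt (2 * x)
  sub_ρ₁ : NotInt (x - P.ρ₁)
  add_ρ₁ : NotInt (x + P.ρ₁)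
  sub_ρ₂ : NotInt (x - P.ρ₂)
  add_ρ₂ : NotInt (x + P.ρ₂)
  sub_r₁ : NotInt (x - P.r₁ + 1 / 2)
  add_r₁ : NotInt (x + P.r₁ + 1 / 2)
  sub_r₂ : NotInt (x - P.r₂ + 1 / 2)
  add_r₂ : NotInt (x + P.r₂ + 1 / 2)

theorem IsRegular.neg {P : Params} {x : ℝ} (h : IsRegular P x) : IsRegular P (-x) where
  two_mul := h.two_mul.of_eq_neg_add 0 (by push_cast; ring)
  sub_ρ₁ := h.add_ρ₁.of_eq_neg_add 0 (by push_cast; ring)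
  add_ρ₁ := h.sub_ρ₁.of_eq_neg_add 0 (by push_cast; ring)
  sub_ρ₂ := h.add_ρ₂.of_eq_neg_add 0 (by push_cast; ring)
  add_ρ₂ := h.sub_ρ₂.of_eq_neg_add 0 (by push_cast; ring)
  sub_r₁ := h.add_r₁.of_eq_neg_add 1 (by push_cast; ring)
  add_r₁ := h.sub_r₁.of_eq_neg_add 1 (by push_cast; ring)
  sub_r₂ := h.add_r₂.of_eq_neg_add 1 (by push_cast; ring)
  add_r₂ := h.sub_r₂.of_eq_neg_add 1 (by push_cast; ring)

theorem IsRegular.neg_sub_one {P : Params} {x : ℝ} (h : IsRegular P x) :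
    IsRegular P (-x - 1) where
  two_mul := h.two_mul.of_eq_neg_add (-2) (by push_cast; ring)
  sub_ρ₁ := h.add_ρ₁.of_eq_neg_add (-1) (by push_cast; ring)
  add_ρ₁ := h.sub_ρ₁.of_eq_neg_add (-1) (by push_cast; ring)
  sub_ρ₂ := h.add_ρ₂.of_eq_neg_add (-1) (by push_cast; ring)
  add_ρ₂ := h.sub_ρ₂.of_eq_neg_add (-1) (by push_cast; ring)
  sub_r₁ := h.add_r₁.of_eq_neg_add 0 (by push_cast; ring)
  add_r₁ := h.sub_r₁.of_eq_neg_add 0 (by push_cast; ring)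
  sub_r₂ := h.add_r₂.of_eq_neg_add 0 (by push_cast; ring)
  add_r₂ := h.sub_r₂.of_eq_neg_add 0 (by push_cast; ring)

/-- The shifts `b` for which regular points `x` have non-integer `x + b`. -/
noncomputable def regularShifts (P : Params) : List ℝ :=
  [-P.ρ₁, P.ρ₁, -P.ρ₂, P.ρ₂, -P.r₁ + 1 / 2, P.r₁ + 1 / 2, -P.r₂ + 1 / 2, P.r₂ + 1 / 2]

theorem isRegular_of_affine {P : Params} {x : ℝ} (h2 : NotInt (2 * x + 0))
    (h : ∀ b ∈ regularShifts P, NotInt (1 * x + b)) : IsRegular P x := by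
  simp only [regularShifts, List.mem_cons, List.not_mem_nil, or_false, forall_eq_or_imp, forall_eq] at h
  obtain ⟨h3, h4, h5, h6, h7, h8, h9, h10⟩ := h
  constructor
  · simpa using h2
  · exact h3.of_eq_add 0 (by push_cast; ring)
  · exact h4.of_eq_add 0 (by push_cast; ring)
  · exact h5.of_eq_add 0 (by push_cast; ring)
  · exact h6.of_eq_add 0 (by push_cast; ring)
  · exact h7.of_eq_add 0 (by push_cast; ring)
  · exact h8.of_eq_add 0 (by push_cast; ring)
  · exact h9.of_eq_add 0 (by push_cast; ring)
  · exact h10.of_eq_add 0 (by push_cast; ring)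

theorem eventually_isRegular (P : Params) (x : ℝ) : ∀ᶠ y in 𝓝[≠] x, IsRegular P y := by
  have h : ∀ l : List ℝ, ∀ᶠ y in 𝓝[≠] x, ∀ b ∈ l, NotInt (1 * y + b) := by
    intro l
    induction l with
    | nil => simp
    | cons b l ih =>
      filter_upwards [ih, eventually_notInt_affine one_ne_zero b x] with y h1 h2
      simpa using ⟨by simpa using h2, by simpa using h1⟩
  filter_upwards [h (regularShifts P), eventually_notInt_affine two_ne_zero 0 x] with y h1 h2
  exact isRegular_of_affine h2 h1

theorem countable_not_isRegular (P : Params) : {y : ℝ | ¬ IsRegular P y}.Countable := by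
  have h : ∀ l : List ℝ, {y : ℝ | ¬ ∀ b ∈ l, NotInt (1 * y + b)}.Countable := by
    intro l
    induction l with
    | nil => simp
    | cons b l ih =>
      refine (ih.union (countable_not_notInt_affine one_ne_zero b)).mono fun y hy => ?_
      by_contra hn
      simp only [Set.mem_union, Set.mem_ofPred_eq, not_or, not_not] at hn
      exact hy (List.forall_mem_cons.mpr ⟨hn.2, hn.1⟩)
  refine ((h (regularShifts P)).union (countable_not_notInt_affine two_ne_zero 0)).mono fun y hy => ?_
  by_contra hn
  simp only [Set.mem_union, Set.mem_ofPred_eq, not_or, not_not] at hn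
  exact hy (isRegular_of_affine hn.2 hn.1)

theorem IsRegular.ne_zero {P : Params} {x : ℝ} (h : IsRegular P x) : x ≠ 0 := fun h0 =>
  h.two_mul.ne_zero (by rw [h0, mul_zero])

theorem IsRegular.two_mul_add_one_ne_zero {P : Params} {x : ℝ} (h : IsRegular P x) :
    2 * x + 1 ≠ 0 := fun h0 => h.two_mul (-1) (by push_cast; linarith)

theorem IsRegular.eta_mul_etaStar_ne_zero {P : Params} {x : ℝ} (h : IsRegular P x)
    (d : GaugeClass) : eta P d x * etaStar P d x ≠ 0 := by
  rw [eta_mul_etaStar]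
  exact mul_ne_zero h.sub_ρ₁.ne_zero h.sub_ρ₂.ne_zero

theorem IsRegular.theta_mul_thetaStar_ne_zero {P : Params} {x : ℝ} (h : IsRegular P x)
    (d : GaugeClass) : theta P d x * thetaStar P d x ≠ 0 := by
  rw [theta_mul_thetaStar]
  exact mul_ne_zero h.add_r₁.ne_zero h.add_r₂.ne_zero

/-! ### Gamma factors and gauge factors under the two reflections -/

theorem gammaNum_neg (r x : ℝ) : gammaNum r (-x) = gammaNum r x := by
  unfold gammaNum
  rw [mul_comm, sub_neg_eq_add, ← sub_eq_add_neg]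

theorem gammaDen_neg_sub_one (ρ x : ℝ) : gammaDen ρ (-x - 1) = gammaDen ρ x := by
  unfold gammaDen
  rw [mul_comm]
  congr 2 <;> ring

theorem gammaNum_neg_sub_one {r x : ℝ} (h1 : x + r + 1 / 2 ≠ 0) (h2 : x - r + 1 / 2 ≠ 0) :
    gammaNum r (-x - 1) * (-x - 1 + r + 1 / 2) = gammaNum r x * (x + r + 1 / 2) := by
  unfold gammaNum
  have e1 := Real.Gamma_add_one h1
  have h2' : -x - 1 + r + 1 / 2 ≠ 0 := fun h => h2 (by linarith)
  have e2 := Real.Gamma_add_one h2'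
  rw [show 1 / 2 + r + x = x + r + 1 / 2 by ring,
    show 1 / 2 + r - x = -x - 1 + r + 1 / 2 + 1 by ring, e2,
    show 1 / 2 + r + (-x - 1) = -x - 1 + r + 1 / 2 by ring,
    show 1 / 2 + r - (-x - 1) = x + r + 1 / 2 + 1 by ring, e1]
  ring

theorem gammaDen_neg {ρ x : ℝ} (h1 : x + ρ ≠ 0) (h2 : x - ρ ≠ 0) :
    gammaDen ρ (-x) * (-x - ρ) = gammaDen ρ x * (x - ρ) := by
  unfold gammaDen
  have e1 := Real.Gamma_add_one h1
  have h2' : ρ - x ≠ 0 := fun h => h2 (by linarith)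
  have e2 := Real.Gamma_add_one h2'
  rw [show 1 + ρ + x = x + ρ + 1 by ring, show 1 + ρ + -x = ρ - x + 1 by ring, e1, e2,
    show ρ - -x = x + ρ by ring]
  ring

theorem gammaNum_ne_zero {r x : ℝ} (h1 : NotInt (x + r + 1 / 2)) (h2 : NotInt (x - r + 1 / 2)) :
    gammaNum r x ≠ 0 :=
  mul_ne_zero (h1.of_eq_add 0 (by push_cast; ring)).gamma_ne_zero
    (h2.of_eq_neg_add 1 (by push_cast; ring)).gamma_ne_zero

theorem gammaDen_ne_zero {ρ x : ℝ} (h1 : NotInt (x + ρ)) (h2 : NotInt (x - ρ)) :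
    gammaDen ρ x ≠ 0 :=
  mul_ne_zero (h2.of_eq_neg_add 0 (by push_cast; ring)).gamma_ne_zero
    (h1.of_eq_add 1 (by push_cast; ring)).gamma_ne_zero

section Gauge

variable {P : Params} {x : ℝ}

theorem xi_ne_zero (h : IsRegular P x) (d : GaugeClass) : xi P d x ≠ 0 := by
  have g1 := gammaNum_ne_zero h.add_r₁ h.sub_r₁
  have g2 := gammaNum_ne_zero h.add_r₂ h.sub_r₂
  have k1 := gammaDen_ne_zero h.add_ρ₁ h.sub_ρ₁
  have k2 := gammaDen_ne_zero h.add_ρ₂ h.sub_ρ₂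
  cases d <;> simp [xi, g1, g2, k1, k2]

/-- The gauge factor under `x ↦ -x`. -/
theorem xi_neg (h : IsRegular P x) (d : GaugeClass) :
    xi P d (-x) * eta P d x = xi P d x * eta P d (-x) := by
  have k1 := gammaDen_ne_zero h.add_ρ₁ h.sub_ρ₁
  have k2 := gammaDen_ne_zero h.add_ρ₂ h.sub_ρ₂
  have l1 := gammaDen_ne_zero h.neg.add_ρ₁ h.neg.sub_ρ₁
  have l2 := gammaDen_ne_zero h.neg.add_ρ₂ h.neg.sub_ρ₂
  have e1 : (gammaDen P.ρ₁ (-x))⁻¹ * (x - P.ρ₁) = (gammaDen P.ρ₁ x)⁻¹ * (-x - P.ρ₁) := by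
    have := gammaDen_neg h.add_ρ₁.ne_zero h.sub_ρ₁.ne_zero
    field_simp
    linear_combination -this
  have e2 : (gammaDen P.ρ₂ (-x))⁻¹ * (x - P.ρ₂) = (gammaDen P.ρ₂ x)⁻¹ * (-x - P.ρ₂) := by
    have := gammaDen_neg h.add_ρ₂.ne_zero h.sub_ρ₂.ne_zero
    field_simp
    linear_combination -this
  cases d <;> simp only [xi, eta, gammaNum_neg, div_eq_mul_inv, mul_inv, one_mul]
  case d2 =>
    linear_combination gammaNum P.r₁ x * gammaNum P.r₂ x *
      ((gammaDen P.ρ₂ (-x))⁻¹ * (x - P.ρ₂) * e1 + (gammaDen P.ρ₁ x)⁻¹ * (-x - P.ρ₁) * e2)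
  case d3 =>
    linear_combination
      (gammaDen P.ρ₂ (-x))⁻¹ * (x - P.ρ₂) * e1 + (gammaDen P.ρ₁ x)⁻¹ * (-x - P.ρ₁) * e2
  case d5 => linear_combination gammaNum P.r₁ x * e1
  case d6 => linear_combination gammaNum P.r₂ x * e2
  case d7 => linear_combination gammaNum P.r₁ x * e2
  case d8 => linear_combination gammaNum P.r₂ x * e1

/-- The gauge factor under `x ↦ -x-1`. -/
theorem xi_neg_sub_one (h : IsRegular P x) (d : GaugeClass) :
    xi P d (-x - 1) * thetaStar P d (-x - 1) = xi P d x * thetaStar P d x := by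
  have e1 := gammaNum_neg_sub_one h.add_r₁.ne_zero h.sub_r₁.ne_zero
  have e2 := gammaNum_neg_sub_one h.add_r₂.ne_zero h.sub_r₂.ne_zero
  have e12 : gammaNum P.r₁ (-x - 1) * gammaNum P.r₂ (-x - 1) *
      ((-x - 1 + P.r₁ + 1 / 2) * (-x - 1 + P.r₂ + 1 / 2)) =
      gammaNum P.r₁ x * gammaNum P.r₂ x * ((x + P.r₁ + 1 / 2) * (x + P.r₂ + 1 / 2)) := by
    rw [mul_mul_mul_comm, e1, e2, mul_mul_mul_comm]
  cases d <;> simp only [xi, thetaStar, gammaDen_neg_sub_one, div_mul_eq_mul_div, e1, e2, e12]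

end Gauge

theorem biWeight_eq (P : Params) (x : ℝ) :
    biWeight P x = Real.sin (2 * Real.pi * x) * gammaNum (-P.r₁) x /
      (gammaNum P.r₂ x * gammaDen (-P.ρ₁) x * gammaDen (-P.ρ₂) x) := by
  simp only [biWeight, gammaNum, gammaDen, ← sub_eq_add_neg]
  ring

/-- The explicit weight of the Bannai-Ito operator. -/
theorem isBannaiItoWeight_biWeight (P : Params) : IsBannaiItoWeight P (biWeight P) := by
  refine ⟨_, countable_not_isRegular P, ?_, ?_⟩
  · intro x hx _
    have h : IsRegular P x := not_not.mp hx
    have k1 := gammaDen_ne_zero (ρ := -P.ρ₁) (x := x) (h.sub_ρ₁.of_eq_add 0 (by push_cast; ring))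
      (h.add_ρ₁.of_eq_add 0 (by push_cast; ring))
    have k2 := gammaDen_ne_zero (ρ := -P.ρ₂) (x := x) (h.sub_ρ₂.of_eq_add 0 (by push_cast; ring))
      (h.add_ρ₂.of_eq_add 0 (by push_cast; ring))
    have l1 := gammaDen_ne_zero (ρ := -P.ρ₁) (x := -x)
      (h.add_ρ₁.of_eq_neg_add 0 (by push_cast; ring))
      (h.sub_ρ₁.of_eq_neg_add 0 (by push_cast; ring))
    have l2 := gammaDen_ne_zero (ρ := -P.ρ₂) (x := -x)
      (h.add_ρ₂.of_eq_neg_add 0 (by push_cast; ring))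
      (h.sub_ρ₂.of_eq_neg_add 0 (by push_cast; ring))
    have e1 : (gammaDen (-P.ρ₁) x)⁻¹ * (x - P.ρ₁) = (gammaDen (-P.ρ₁) (-x))⁻¹ * (-x - P.ρ₁) := by
      have := gammaDen_neg (ρ := -P.ρ₁) (x := x) (by simpa [sub_eq_add_neg] using h.sub_ρ₁.ne_zero)
        (by simpa using h.add_ρ₁.ne_zero)
      field_simp
      linear_combination -this
    have e2 : (gammaDen (-P.ρ₂) x)⁻¹ * (x - P.ρ₂) = (gammaDen (-P.ρ₂) (-x))⁻¹ * (-x - P.ρ₂) := by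
      have := gammaDen_neg (ρ := -P.ρ₂) (x := x) (by simpa [sub_eq_add_neg] using h.sub_ρ₂.ne_zero)
        (by simpa using h.add_ρ₂.ne_zero)
      field_simp
      linear_combination -this
    -- The Gamma quotient times (x-ρ₁)(x-ρ₂) is even; the odd sine compensates the denominator -2x
    -- of α.
    rw [biWeight_eq, biWeight_eq, gammaNum_neg, gammaNum_neg, mul_neg, Real.sin_neg]
    simp only [alpha, div_eq_mul_inv, mul_inv, mul_neg, inv_neg, neg_neg, neg_mul]
    linear_combination -(Real.sin (2 * Real.pi * x) * gammaNum (-P.r₁) x *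
      (gammaNum P.r₂ x)⁻¹ * x⁻¹ * 2⁻¹) * ((gammaDen (-P.ρ₂) x)⁻¹ * (x - P.ρ₂) * e1 +
        (gammaDen (-P.ρ₁) (-x))⁻¹ * (-x - P.ρ₁) * e2)
  · intro x hx _
    have h : IsRegular P x := not_not.mp hx
    have g := gammaNum_ne_zero h.add_r₂ h.sub_r₂
    have g' := gammaNum_ne_zero h.neg_sub_one.add_r₂ h.neg_sub_one.sub_r₂
    have e1 := gammaNum_neg_sub_one (r := -P.r₁) (x := x)
      (by simpa [sub_eq_add_neg] using h.sub_r₁.ne_zero) (by simpa using h.add_r₁.ne_zero)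
    have e2 : (gammaNum P.r₂ x)⁻¹ * (x - P.r₂ + 1 / 2) =
        -((gammaNum P.r₂ (-x - 1))⁻¹ * (x + P.r₂ + 1 / 2)) := by
      have := gammaNum_neg_sub_one h.add_r₂.ne_zero h.sub_r₂.ne_zero
      field_simp
      linear_combination -2 * this
    have hs : Real.sin (2 * Real.pi * (-x - 1)) = -Real.sin (2 * Real.pi * x) := by
      rw [show 2 * Real.pi * (-x - 1) = -(2 * Real.pi * x) - 2 * Real.pi by ring,
        Real.sin_sub_two_pi, Real.sin_neg]
    -- The sine changes sign under x ↦ -x-1 just as the denominator 2x+1 of β does; the remaining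
    -- product is invariant.
    rw [biWeight_eq, biWeight_eq, gammaDen_neg_sub_one, gammaDen_neg_sub_one, hs]
    simp only [beta, div_eq_mul_inv, mul_inv]
    rw [show 2 * (-x - 1) + 1 = -(2 * x + 1) by ring, inv_neg]
    linear_combination (Real.sin (2 * Real.pi * x) * (gammaDen (-P.ρ₁) x)⁻¹ *
      (gammaDen (-P.ρ₂) x)⁻¹ * (2 * x + 1)⁻¹) * (-(gammaNum P.r₂ x)⁻¹ * (x - P.r₂ + 1 / 2) * e1 +
        gammaNum (-P.r₁) (-x - 1) * (-x - 1 - P.r₁ + 1 / 2) * e2)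

/-! ### Cancellation of the gauge factor at regular points -/

section Regular

variable {P : Params} {d : GaugeClass} {m : ℕ} {a t : ℝ → ℝ} {x : ℝ}

theorem IsRegular.eta_ne_zero (h : IsRegular P x) (d : GaugeClass) : eta P d x ≠ 0 :=
  left_ne_zero_of_mul (h.eta_mul_etaStar_ne_zero d)

theorem IsRegular.thetaStar_ne_zero (h : IsRegular P x) (d : GaugeClass) :
    thetaStar P d x ≠ 0 :=
  right_ne_zero_of_mul (h.theta_mul_thetaStar_ne_zero d)

theorem alpha_eq (P : Params) (d : GaugeClass) (x : ℝ) :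
    alpha P x = eta P d x * etaStar P d x / (-2 * x) := by
  rw [eta_mul_etaStar, alpha]

/-- Since -x-1+r+1/2 = -(x-r+1/2), the two signs in the product cancel. -/
theorem beta_eq (P : Params) (d : GaugeClass) (x : ℝ) :
    beta P x = theta P d (-x - 1) * thetaStar P d (-x - 1) / (2 * x + 1) := by
  rw [theta_mul_thetaStar, beta]
  congr 1
  ring

theorem beta_neg_sub_one (P : Params) (d : GaugeClass) (x : ℝ) :
    beta P (-x - 1) = -(theta P d x * thetaStar P d x / (2 * x + 1)) := by
  rw [beta_eq P d, show -(-x - 1) - 1 = x by ring, show 2 * (-x - 1) + 1 = -(2 * x + 1) by ring,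
    div_neg]

theorem chi_eq (hq : IsSeedQuotient P d (seedPoly P d m) a t) (h : IsRegular P x) :
    chi P d m x = xi P d x * (x * a x) / eta P d x := by
  have he := h.eta_ne_zero d
  rw [← hq.a_eq, chi, seed, seed, eq_div_iff he]
  linear_combination -seedPoly P d m (-x) * xi_neg h d

theorem chiTilde_eq (hq : IsSeedQuotient P d (seedPoly P d m) a t) (h : IsRegular P x) :
    chiTilde P d m x = -(thetaStar P d x * xi P d x * t x) := by
  have h2 := h.two_mul_add_one_ne_zero
  rw [chiTilde, seed, seed, beta_neg_sub_one P d, beta_eq P d x]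
  have ht : t x = (theta P d x * seedPoly P d m x -
      theta P d (-x - 1) * seedPoly P d m (-x - 1)) / (2 * x + 1) := by
    rw [hq.t_eq, mul_div_cancel_left₀ _ h2]
  rw [ht]
  linear_combination theta P d (-x - 1) * seedPoly P d m (-x - 1) / (2 * x + 1) *
    xi_neg_sub_one h d

theorem decoupling_eq (hq : IsSeedQuotient P d (seedPoly P d m) a t) (h : IsRegular P x) :
    decoupling P d m x = -(thetaStar P d x * xi P d x * t x * a x) := by
  have he := h.eta_ne_zero d
  have hx := h.ne_zero
  have hxi := xi_ne_zero h d
  rw [decoupling, chi_eq hq h, chiTilde_eq hq h]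
  field_simp

theorem chi_ne_zero (hq : IsSeedQuotient P d (seedPoly P d m) a t) (h : IsRegular P x)
    (ha : a x ≠ 0) : chi P d m x ≠ 0 := by
  rw [chi_eq hq h]
  exact div_ne_zero (mul_ne_zero (xi_ne_zero h d) (mul_ne_zero h.ne_zero ha)) (h.eta_ne_zero d)

theorem chiTilde_ne_zero (hq : IsSeedQuotient P d (seedPoly P d m) a t) (h : IsRegular P x)
    (ht : t x ≠ 0) : chiTilde P d m x ≠ 0 := by
  rw [chiTilde_eq hq h]
  exact neg_ne_zero.mpr (mul_ne_zero (mul_ne_zero (h.thetaStar_ne_zero d) (xi_ne_zero h d)) ht)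

theorem decoupling_ne_zero (hq : IsSeedQuotient P d (seedPoly P d m) a t) (h : IsRegular P x)
    (ha : a x ≠ 0) (ht : t x ≠ 0) : decoupling P d m x ≠ 0 := by
  rw [decoupling_eq hq h]
  exact neg_ne_zero.mpr (mul_ne_zero
    (mul_ne_zero (mul_ne_zero (h.thetaStar_ne_zero d) (xi_ne_zero h d)) ht) ha)

/-- The decoupling coefficient carries exactly the denominators of 1/χ and 1/χ̃, so the result is
polynomial. Nonzero a and t are needed because division by zero yields 0. -/
theorem dressing_eq (hq : IsSeedQuotient P d (seedPoly P d m) a t) {f D S : ℝ → ℝ}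
    (hd : IsDressQuotient P f D S) (h : IsRegular P x) (ha : a x ≠ 0) (ht : t x ≠ 0) :
    dressing P d m f x = -(thetaStar P d x * t x * eta P d x * D x) + a x * S x := by
  have he := h.eta_ne_zero d
  have hx := h.ne_zero
  have h2 := h.two_mul_add_one_ne_zero
  have hxi := xi_ne_zero h d
  have hv := h.thetaStar_ne_zero d
  have hS : beta P x * f (-x - 1) + beta P (-x - 1) * f x = S x := by
    have hb : beta P (-x - 1) = -((x + P.r₁ + 1 / 2) * (x + P.r₂ + 1 / 2) / (2 * x + 1)) := by
      rw [beta_neg_sub_one P d, theta_mul_thetaStar]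
    rw [hb, beta, ← mul_right_inj' h2, ← hd.S_eq]
    generalize 2 * x + 1 = z at h2
    field_simp
    ring
  rw [dressing, hS, hd.D_eq, chi_eq hq h, chiTilde_eq hq h, decoupling_eq hq h]
  field_simp
  ring

/-- The coefficient of `R` in the exceptional operator, as a rational function. -/
theorem alphaHat_formula (hq : IsSeedQuotient P d (seedPoly P d m) a t) (h : IsRegular P x)
    (ha : a x ≠ 0) (ht : t (-x) ≠ 0) :
    decoupling P d m x * chiTilde P d m (-x) / (decoupling P d m (-x) * chi P d m x) =
      -(eta P d x * thetaStar P d x * t x) / (x * a x) := by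
  have he := h.eta_ne_zero d
  have hx := h.ne_zero
  have hxi := xi_ne_zero h d
  have hxi' := xi_ne_zero h.neg d
  have hv := h.neg.thetaStar_ne_zero d
  rw [chi_eq hq h, chiTilde_eq hq h.neg, decoupling_eq hq h, decoupling_eq hq h.neg, hq.a_even]
  field_simp

/-- The coefficient of `TR` in the exceptional operator, as a rational function. -/
theorem betaHat_formula (hq : IsSeedQuotient P d (seedPoly P d m) a t) (h : IsRegular P x)
    (ha : a (-x - 1) ≠ 0) (ht : t x ≠ 0) :
    decoupling P d m x * alpha P (-x - 1) * beta P x * chi P d m (-x - 1) /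
        (decoupling P d m (-x - 1) * chiTilde P d m x) =
      a x * etaStar P d (-x - 1) * theta P d (-x - 1) / (2 * (2 * x + 1) * t x) := by
  have hr := h.neg_sub_one
  have he := hr.eta_ne_zero d
  have hx := hr.ne_zero
  have h2 := h.two_mul_add_one_ne_zero
  have hxi := xi_ne_zero h d
  have hxi' := xi_ne_zero hr d
  have hv := h.thetaStar_ne_zero d
  have hv' := hr.thetaStar_ne_zero d
  have hg := xi_neg_sub_one h d
  rw [chi_eq hq hr, chiTilde_eq hq h, decoupling_eq hq h, decoupling_eq hq hr, hq.t_symm,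
    alpha_eq P d, beta_eq P d]
  generalize 2 * x + 1 = z at *
  generalize -x - 1 = y at *
  rw [mul_comm (thetaStar P d y) (xi P d y), hg]
  field_simp
  linear_combination a x * etaStar P d y * theta P d y * hg

/-- The weight of the exceptional operator does not involve the gauge factor. -/
theorem xbiWeight_eq (hq : IsSeedQuotient P d (seedPoly P d m) a t) (h : IsRegular P x)
    (ha : a x ≠ 0) (ht : t x ≠ 0) (c ω : ℝ → ℝ) :
    xbiWeight P d m c ω x =
      c x * (etaStar P d x / (thetaStar P d x) * ω x) / (2 * (a x * t x)) := by
  have he := h.eta_ne_zero d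
  have hx := h.ne_zero
  have hxi := xi_ne_zero h d
  have hv := h.thetaStar_ne_zero d
  rw [xbiWeight, chi_eq hq h, chiTilde_eq hq h, decoupling_eq hq h, alpha_eq P d]
  field_simp

/-- The weight relation of the exceptional operator for `x ↦ -x`. -/
theorem xbiWeight_mul_neg (hq : IsSeedQuotient P d (seedPoly P d m) a t) (h : IsRegular P x)
    (ha : a x ≠ 0) (ht : t x ≠ 0) (ht' : t (-x) ≠ 0) {c ω : ℝ → ℝ} (hc : c (-x) = c x)
    (hω : ω x * alpha P x = ω (-x) * alpha P (-x)) :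
    xbiWeight P d m c ω x * (decoupling P d m x * chiTilde P d m (-x) /
        (decoupling P d m (-x) * chi P d m x)) =
      xbiWeight P d m c ω (-x) * (decoupling P d m (-x) * chiTilde P d m (- -x) /
        (decoupling P d m (- -x) * chi P d m (-x))) := by
  have ha' : a (-x) ≠ 0 := by rwa [hq.a_even]
  have h1 := chi_ne_zero hq h ha
  have h2 := chi_ne_zero hq h.neg ha'
  have h3 := decoupling_ne_zero hq h ha ht
  have h4 := decoupling_ne_zero hq h.neg ha' ht'
  rw [neg_neg]
  simp only [xbiWeight, hc]
  field_simp
  linear_combination c x * chiTilde P d m x * chiTilde P d m (-x) * hω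

/-- The weight relation of the exceptional operator for `x ↦ -x-1`. -/
theorem xbiWeight_mul_neg_sub_one (hq : IsSeedQuotient P d (seedPoly P d m) a t)
    (h : IsRegular P x) (ha : a x ≠ 0) (ha' : a (-x - 1) ≠ 0) (ht : t x ≠ 0)
    {c ω : ℝ → ℝ} (hc : c (-x - 1) = c x)
    (hω : ω x * beta P x = ω (-x - 1) * beta P (-x - 1)) :
    xbiWeight P d m c ω x * (decoupling P d m x * alpha P (-x - 1) * beta P x *
        chi P d m (-x - 1) / (decoupling P d m (-x - 1) * chiTilde P d m x)) =
      xbiWeight P d m c ω (-x - 1) * (decoupling P d m (-x - 1) * alpha P (-(-x - 1) - 1) *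
        beta P (-x - 1) * chi P d m (-(-x - 1) - 1) /
          (decoupling P d m (-(-x - 1) - 1) * chiTilde P d m (-x - 1))) := by
  have ht' : t (-x - 1) ≠ 0 := by rwa [hq.t_symm]
  have h1 := chiTilde_ne_zero hq h ht
  have h2 := chiTilde_ne_zero hq h.neg_sub_one ht'
  have h3 := decoupling_ne_zero hq h ha ht
  have h4 := decoupling_ne_zero hq h.neg_sub_one ha' ht'
  rw [show -(-x - 1) - 1 = x by ring]
  simp only [xbiWeight, hc]
  generalize -x - 1 = y at *
  field_simp
  linear_combination c x * chi P d m x * alpha P x * alpha P y * chi P d m y * hω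

end Regular

/-! ### Removal of the singularities -/

section Limits

variable {P : Params} {d : GaugeClass} {m : ℕ} {a t : ℝ[X]} {x : ℝ}

theorem eventually_eval_ne_zero {q : ℝ[X]} (hq : q ≠ 0) (x : ℝ) :
    ∀ᶠ y in 𝓝[≠] x, q.eval y ≠ 0 := by
  have hfin : (q.rootSet ℝ).Finite := q.rootSet_finite ℝ
  have h := (hfin.subset (Set.sdiff_subset (t := {x}))).isClosed.isOpen_compl.mem_nhds
    (show x ∈ (q.rootSet ℝ \ {x})ᶜ by simp)
  filter_upwards [nhdsWithin_le_nhds h, self_mem_nhdsWithin] with y hy hyx h0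
  exact hy ⟨by simp [mem_rootSet, hq, h0], hyx⟩

theorem eventually_eval_neg_ne_zero {q : ℝ[X]} (hq : q ≠ 0) (x : ℝ) :
    ∀ᶠ y in 𝓝[≠] x, q.eval (-y) ≠ 0 := by
  have hq' : q.comp (-X) ≠ 0 := fun h0 => hq <| by
    have := congrArg (fun p : ℝ[X] => p.comp (-X)) h0
    simpa [comp_assoc] using this
  filter_upwards [eventually_eval_ne_zero hq' x] with y hy
  simpa [eval_comp] using hy

theorem eventually_eval_neg_sub_one_ne_zero {q : ℝ[X]} (hq : q ≠ 0) (x : ℝ) :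
    ∀ᶠ y in 𝓝[≠] x, q.eval (-y - 1) ≠ 0 := by
  have hq' : q.comp (-X - 1) ≠ 0 := fun h0 => hq <| by
    have := congrArg (fun p : ℝ[X] => p.comp (-X - 1)) h0
    simpa [comp_assoc] using this
  filter_upwards [eventually_eval_ne_zero hq' x] with y hy
  simpa [eval_comp] using hy

theorem continuous_eta (P : Params) (d : GaugeClass) : Continuous (eta P d) := by
  obtain ⟨q, hq⟩ := exists_eta_poly P d
  exact (funext hq : (fun x => q.eval x) = _) ▸ q.continuous

theorem continuous_etaStar (P : Params) (d : GaugeClass) : Continuous (etaStar P d) := by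
  obtain ⟨q, hq⟩ := exists_etaStar_poly P d
  exact (funext hq : (fun x => q.eval x) = _) ▸ q.continuous

theorem continuous_theta (P : Params) (d : GaugeClass) : Continuous (theta P d) := by
  obtain ⟨q, hq⟩ := exists_theta_poly P d
  exact (funext hq : (fun x => q.eval x) = _) ▸ q.continuous

theorem continuous_thetaStar (P : Params) (d : GaugeClass) : Continuous (thetaStar P d) := by
  obtain ⟨q, hq⟩ := exists_thetaStar_poly P d
  exact (funext hq : (fun x => q.eval x) = _) ▸ q.continuous

/-- The factor t(-y) cancels from the raw quotient. It is nonzero for y ≠ x near x because t is a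
nonzero polynomial, so no condition on t at -x is required. -/
theorem tendsto_alphaHat
    (hq : IsSeedQuotient P d (seedPoly P d m) (fun x => a.eval x) (fun x => t.eval x))
    (hx : x ≠ 0) (ha : a.eval x ≠ 0) (ht : t ≠ 0) :
    Tendsto (fun x => decoupling P d m x * chiTilde P d m (-x) /
      (decoupling P d m (-x) * chi P d m x)) (𝓝[≠] x)
      (𝓝 (-(eta P d x * thetaStar P d x * t.eval x) / (x * a.eval x))) := by
  have ha0 : a ≠ 0 := fun h => ha (by simp [h])
  have hc : ContinuousAt
      (fun x => -(eta P d x * thetaStar P d x * t.eval x) / (x * a.eval x)) x :=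
    (((continuous_eta P d).mul (continuous_thetaStar P d)).mul t.continuous).neg.continuousAt.div
      (continuous_id.mul a.continuous).continuousAt (mul_ne_zero hx ha)
  refine (hc.tendsto.mono_left nhdsWithin_le_nhds).congr' ?_
  filter_upwards [eventually_isRegular P x, eventually_eval_ne_zero ha0 x,
    eventually_eval_neg_ne_zero ht x] with y h1 h2 h3
  exact (alphaHat_formula hq h1 h2 h3).symm

theorem alphaHat_eq
    (hq : IsSeedQuotient P d (seedPoly P d m) (fun x => a.eval x) (fun x => t.eval x))
    (hx : x ≠ 0) (ha : a.eval x ≠ 0) (ht : t ≠ 0) :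
    alphaHat P d m x = -(eta P d x * thetaStar P d x * t.eval x) / (x * a.eval x) :=
  (tendsto_alphaHat hq hx ha ht).limUnder_eq

theorem tendsto_betaHat
    (hq : IsSeedQuotient P d (seedPoly P d m) (fun x => a.eval x) (fun x => t.eval x))
    (hx : 2 * x + 1 ≠ 0) (ha : a ≠ 0) (ht : t.eval x ≠ 0) :
    Tendsto (fun x => decoupling P d m x * alpha P (-x - 1) * beta P x * chi P d m (-x - 1) /
      (decoupling P d m (-x - 1) * chiTilde P d m x)) (𝓝[≠] x)
      (𝓝 (a.eval x * etaStar P d (-x - 1) * theta P d (-x - 1) /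
        (2 * (2 * x + 1) * t.eval x))) := by
  have ht0 : t ≠ 0 := fun h => ht (by simp [h])
  have hr : Continuous fun x : ℝ => -x - 1 := by fun_prop
  have hc : ContinuousAt (fun x => a.eval x * etaStar P d (-x - 1) * theta P d (-x - 1) /
      (2 * (2 * x + 1) * t.eval x)) x := by
    refine ContinuousAt.div ?_ ?_ (mul_ne_zero (mul_ne_zero two_ne_zero hx) ht)
    · exact ((a.continuous.mul ((continuous_etaStar P d).comp hr)).mul
        ((continuous_theta P d).comp hr)).continuousAt
    · have : Continuous fun x : ℝ => 2 * (2 * x + 1) := by fun_prop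
      exact (this.mul t.continuous).continuousAt
  refine (hc.tendsto.mono_left nhdsWithin_le_nhds).congr' ?_
  filter_upwards [eventually_isRegular P x, eventually_eval_ne_zero ht0 x,
    eventually_eval_neg_sub_one_ne_zero ha x] with y h1 h2 h3
  exact (betaHat_formula hq h1 h3 h2).symm

theorem betaHat_eq
    (hq : IsSeedQuotient P d (seedPoly P d m) (fun x => a.eval x) (fun x => t.eval x))
    (hx : 2 * x + 1 ≠ 0) (ha : a ≠ 0) (ht : t.eval x ≠ 0) :
    betaHat P d m x = a.eval x * etaStar P d (-x - 1) * theta P d (-x - 1) /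
        (2 * (2 * x + 1) * t.eval x) :=
  (tendsto_betaHat hq hx ha ht).limUnder_eq

/-- The exceptional polynomial in terms of the polynomial quotients. -/
theorem xbi_eval
    (hq : IsSeedQuotient P d (seedPoly P d m) (fun x => a.eval x) (fun x => t.eval x))
    (ha : a ≠ 0) (ht : t ≠ 0) {n : ℕ} {D S : ℝ[X]}
    (hd : IsDressQuotient P (fun x => (bannaiIto P n).eval x) (fun x => D.eval x)
      (fun x => S.eval x)) (x : ℝ) :
    (xbi P d m n).eval x =
      -(thetaStar P d x * t.eval x * eta P d x * D.eval x) + a.eval x * S.eval x := by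
  obtain ⟨e, he⟩ := exists_eta_poly P d
  obtain ⟨v, hv⟩ := exists_thetaStar_poly P d
  set Q : ℝ[X] := -(v * t * e * D) + a * S with hQ
  have hQx : ∀ y, Q.eval y =
      -(thetaStar P d y * t.eval y * eta P d y * D.eval y) + a.eval y * S.eval y := fun y => by
    simp [hQ, he, hv]
  have hex : ∃ C : Set ℝ, C.Countable ∧
      ∀ x : ℝ, x ∉ C → Q.eval x = dressing P d m (fun y => (bannaiIto P n).eval y) x := by
    refine ⟨{y | ¬ IsRegular P y} ∪ (a.rootSet ℝ ∪ t.rootSet ℝ),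
      (countable_not_isRegular P).union
        ((a.rootSet_finite ℝ).countable.union (t.rootSet_finite ℝ).countable), fun y hy => ?_⟩
    simp only [Set.mem_union, Set.mem_ofPred_eq, not_or, not_not, mem_rootSet, ne_eq, ha, ht,
      not_false_eq_true, true_and, coe_aeval_eq_eval] at hy
    rw [hQx, dressing_eq hq hd hy.1 hy.2.1 hy.2.2]
  obtain ⟨C₁, hC₁, h₁⟩ := hex
  obtain ⟨C₂, hC₂, h₂⟩ := Classical.epsilon_spec (p := fun Q : ℝ[X] => ∃ C : Set ℝ, C.Countable ∧
    ∀ x : ℝ, x ∉ C → Q.eval x = dressing P d m (fun y => (bannaiIto P n).eval y) x)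
    ⟨Q, C₁, hC₁, h₁⟩
  -- Two polynomials agreeing with the dressed function off countable sets coincide, so the choice
  -- in `xbi` is immaterial.
  have : xbi P d m n = Q := by
    refine eq_of_eval_eq_off_countable (hC₁.union hC₂) fun y hy => ?_
    rw [Set.mem_union, not_or] at hy
    rw [h₁ y hy.1]
    exact h₂ y hy.2
  rw [this, hQx]

end Limits

/-! ### Symmetry of a finite weighted reflection operator -/

section Orthogonality

/-- Points whose reflection leaves S contribute nothing, as F vanishes there. On the remaining
points σ is a bijection leaving w F invariant, and substituting it exchanges f and g. -/
theorem sum_weight_symm {S : Finset ℝ} {σ : ℝ → ℝ} (hσ : ∀ x, σ (σ x) = x) {F w : ℝ → ℝ}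
    (hw : ∀ x ∈ S, σ x ∈ S → w x * F x = w (σ x) * F (σ x))
    (hF : ∀ x ∈ S, σ x ∈ S ∨ F x = 0) (f g : ℝ → ℝ) :
    ∑ x ∈ S, w x * F x * (f x * g (σ x)) = ∑ x ∈ S, w x * F x * (g x * f (σ x)) := by
  have key : ∀ f g : ℝ → ℝ, ∑ x ∈ S with σ x ∈ S, w x * F x * (f x * g (σ x)) =
      ∑ x ∈ S, w x * F x * (f x * g (σ x)) := fun f g => by
    refine Finset.sum_filter_of_ne fun x hx hne => (hF x hx).resolve_right fun h0 => hne ?_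
    rw [h0]; ring
  rw [← key f g, ← key g f]
  refine Finset.sum_nbij' σ σ ?_ ?_ (fun x _ => hσ x) (fun x _ => hσ x) ?_
  · intro x hx
    rw [Finset.mem_filter] at hx ⊢
    exact ⟨hx.2, by rw [hσ]; exact hx.1⟩
  · intro x hx
    rw [Finset.mem_filter] at hx ⊢
    exact ⟨hx.2, by rw [hσ]; exact hx.1⟩
  · intro x hx
    rw [Finset.mem_filter] at hx
    rw [hσ, ← hw x hx.1 hx.2]
    ring

/-- Eigenfunctions of a Dunkl shift operator to different eigenvalues are orthogonal on a finite
set which the operator does not leave. -/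
theorem sum_weight_eq_zero {S : Finset ℝ} {F G K w f g : ℝ → ℝ} {l l' : ℝ}
    (hw : IsWeightOn S F G w) (hF : ∀ x ∈ S, -x ∈ S ∨ F x = 0)
    (hG : ∀ x ∈ S, -x - 1 ∈ S ∨ G x = 0)
    (hf : ∀ x ∈ S, F x * f (-x) + G x * f (-x - 1) - K x * f x = l * f x)
    (hg : ∀ x ∈ S, F x * g (-x) + G x * g (-x - 1) - K x * g x = l' * g x) (hl : l ≠ l') :
    ∑ x ∈ S, w x * f x * g x = 0 := by
  have h1 := sum_weight_symm (σ := fun x => -x) neg_neg hw.1 hF f g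
  have h2 := sum_weight_symm (σ := fun x => -x - 1) (fun x => by ring) hw.2 hG f g
  have h3 : (l - l') * ∑ x ∈ S, w x * f x * g x =
      (∑ x ∈ S, w x * F x * (g x * f (-x)) - ∑ x ∈ S, w x * F x * (f x * g (-x))) +
        (∑ x ∈ S, w x * G x * (g x * f (-x - 1)) -
          ∑ x ∈ S, w x * G x * (f x * g (-x - 1))) := by
    rw [Finset.mul_sum, ← Finset.sum_sub_distrib, ← Finset.sum_sub_distrib,
      ← Finset.sum_add_distrib]
    refine Finset.sum_congr rfl fun x hx => ?_
    linear_combination -(w x * g x) * hf x hx + w x * f x * hg x hx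
  rw [h1, h2, sub_self, sub_self, add_zero] at h3
  exact (mul_eq_zero.mp h3).resolve_left (sub_ne_zero.mpr hl)

end Orthogonality

/-! ### The grid as a chain of reflections that ends at zeros of the coefficients -/

section Grid

variable {P : Params} {d : GaugeClass} {N : ℕ}

/-- From this and `gridPoint_odd`: x ↦ -x-1 exchanges x_{2k} and x_{2k+1}, and x ↦ -x exchanges
x_{2k+1} and x_{2k+2}. Only the two ends of the chain can be left. -/
theorem gridPoint_even (P : Params) (k : ℕ) : gridPoint P (2 * k) = P.ρ₂ + k := by
  have : (-1 : ℝ) ^ (2 * k) = 1 := by rw [pow_mul]; simp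
  rw [gridPoint, this]
  push_cast
  ring

theorem gridPoint_odd (P : Params) (k : ℕ) : gridPoint P (2 * k + 1) = -P.ρ₂ - k - 1 := by
  have : (-1 : ℝ) ^ (2 * k + 1) = -1 := by rw [pow_succ, pow_mul]; simp
  rw [gridPoint, this]
  push_cast
  ring

theorem mem_grid_even {k : ℕ} (h : 2 * k ∈ gridIndices N d) : P.ρ₂ + k ∈ grid P N d := by
  rw [← gridPoint_even]
  exact Finset.mem_image_of_mem _ h

theorem mem_grid_odd {k : ℕ} (h : 2 * k + 1 ∈ gridIndices N d) :
    -P.ρ₂ - k - 1 ∈ grid P N d := by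
  rw [← gridPoint_odd]
  exact Finset.mem_image_of_mem _ h

theorem grid_cases {x : ℝ} (h : x ∈ grid P N d) : ∃ k : ℕ,
    (2 * k ∈ gridIndices N d ∧ x = P.ρ₂ + k) ∨
      (2 * k + 1 ∈ gridIndices N d ∧ x = -P.ρ₂ - k - 1) := by
  obtain ⟨s, hs, rfl⟩ := Finset.mem_image.mp h
  obtain ⟨k, rfl | rfl⟩ := Nat.even_or_odd' s
  · exact ⟨k, Or.inl ⟨hs, gridPoint_even P k⟩⟩
  · exact ⟨k, Or.inr ⟨hs, gridPoint_odd P k⟩⟩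

/-- The truncation condition, with the parity of `N` made explicit. -/
def Truncated (P : Params) (N : ℕ) : Prop :=
  ∃ j : ℕ, (N = 2 * j + 1 ∧ P.r₂ = P.ρ₂ + j + 1 / 2) ∨ (N = 2 * (j + 1) ∧ P.ρ₁ = -P.ρ₂ - j - 1)

theorem truncated_of (hN : 0 < N) (h : (Odd N ∧ P.r₂ = P.ρ₂ + (N : ℝ) / 2) ∨
    (Even N ∧ P.ρ₁ = -P.ρ₂ - (N : ℝ) / 2)) : Truncated P N := by
  rcases h with ⟨⟨j, rfl⟩, h⟩ | ⟨⟨j, rfl⟩, h⟩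
  · exact ⟨j, Or.inl ⟨rfl, by rw [h]; push_cast; ring⟩⟩
  -- N > 0 excludes j = 0, and writing N as 2(i+1) avoids truncated subtraction in the index bounds.
  · obtain ⟨i, rfl⟩ : ∃ i, j = i + 1 := ⟨j - 1, by omega⟩
    exact ⟨i, Or.inr ⟨by ring, by rw [h]; push_cast; ring⟩⟩

theorem gridIndices_odd (j : ℕ) (d : GaugeClass) : gridIndices (2 * j + 1) d =
    match d with
    | .d1 | .d5 => Finset.Icc 1 (2 * j)
    | .d2 | .d6 => Finset.Icc 0 (2 * j + 1)
    | .d3 | .d7 => Finset.Icc 0 (2 * j)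
    | .d4 | .d8 => Finset.Icc 1 (2 * j + 1) := by
  have h : Odd (2 * j + 1) := ⟨j, rfl⟩
  cases d <;> simp [gridIndices, h]

theorem gridIndices_even (j : ℕ) (d : GaugeClass) : gridIndices (2 * (j + 1)) d =
    match d with
    | .d1 | .d4 => Finset.Icc 1 (2 * j)
    | .d2 | .d3 => Finset.Icc 0 (2 * j + 1)
    | .d5 | .d8 => Finset.Icc 1 (2 * j + 1)
    | .d6 | .d7 => Finset.Icc 0 (2 * j) := by
  have h : ¬ Odd (2 * (j + 1)) := by simp
  have h1 : 2 * (j + 1) - 1 = 2 * j + 1 := by omega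
  have h2 : 2 * (j + 1) - 2 = 2 * j := by omega
  cases d <;> simp [gridIndices, h1, h2]

/-- The grid contains x_0 = ρ₂ only in the classes where x-ρ₂ is a factor of η, so the step from x_0
to -x_0 is blocked. -/
theorem eta_zero_of_mem (hT : Truncated P N) (h : 0 ∈ gridIndices N d) : eta P d P.ρ₂ = 0 := by
  obtain ⟨j, ⟨rfl, -⟩ | ⟨rfl, -⟩⟩ := hT
  · rw [gridIndices_odd] at h
    cases d <;> simp [eta] at h ⊢
  · rw [gridIndices_even] at h
    cases d <;> simp [eta] at h ⊢

theorem pred_mem_gridIndices (hT : Truncated P N) {k : ℕ} (h : 2 * k + 2 ∈ gridIndices N d) :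
    2 * k + 1 ∈ gridIndices N d := by
  obtain ⟨j, ⟨rfl, -⟩ | ⟨rfl, -⟩⟩ := hT
  · rw [gridIndices_odd] at h ⊢
    cases d <;> simp only [Finset.mem_Icc] at h ⊢ <;> omega
  · rw [gridIndices_even] at h ⊢
    cases d <;> simp only [Finset.mem_Icc] at h ⊢ <;> omega

/-- Away from the lower end x_{2k} precedes x_{2k+1} in the grid. If x_0 is missing, x-ρ₂ is a
factor of η*, which blocks the step from x_1 to x_0. -/
theorem even_mem_or_etaStar_zero (hT : Truncated P N) {k : ℕ}
    (h : 2 * k + 1 ∈ gridIndices N d) :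
    2 * k ∈ gridIndices N d ∨ k = 0 ∧ etaStar P d P.ρ₂ = 0 := by
  by_cases hk : k = 0
  · subst hk
    obtain ⟨j, ⟨rfl, -⟩ | ⟨rfl, -⟩⟩ := hT
    · rw [gridIndices_odd]
      cases d <;> simp [etaStar]
    · rw [gridIndices_even]
      cases d <;> simp [etaStar]
  · left
    obtain ⟨i, rfl⟩ : ∃ i, k = i + 1 := ⟨k - 1, by omega⟩
    obtain ⟨j, ⟨rfl, -⟩ | ⟨rfl, -⟩⟩ := hT
    · rw [gridIndices_odd] at h ⊢
      cases d <;> simp only [Finset.mem_Icc] at h ⊢ <;> omega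
    · rw [gridIndices_even] at h ⊢
      cases d <;> simp only [Finset.mem_Icc] at h ⊢ <;> omega

/-- At an odd upper end k = j: the point is x_N with x_N+r₂+1/2 = 0 for N odd, or x_{N-1} = ρ₁ for N
even. It lies in the grid exactly when the vanishing factor belongs to ϑ* or to η, respectively. -/
theorem succ_mem_or_zero_of_odd (hT : Truncated P N) {k : ℕ} (h : 2 * k + 1 ∈ gridIndices N d) :
    2 * (k + 1) ∈ gridIndices N d ∨
      eta P d (-P.ρ₂ - k - 1) * thetaStar P d (-P.ρ₂ - k - 1) = 0 := by
  by_cases hs : 2 * (k + 1) ∈ gridIndices N d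
  · exact Or.inl hs
  right
  obtain ⟨j, ⟨rfl, hP⟩ | ⟨rfl, hP⟩⟩ := hT
  · rw [gridIndices_odd] at h hs
    have hz : j = k → -P.ρ₂ - k - 1 + P.r₂ + 1 / 2 = 0 := fun e => by rw [hP, e]; ring
    cases d <;> simp only [Finset.mem_Icc] at h hs <;> first
      | omega
      | simp only [thetaStar, hz (by omega), mul_zero]
  · rw [gridIndices_even] at h hs
    have hz : j = k → -P.ρ₂ - k - 1 - P.ρ₁ = 0 := fun e => by rw [hP, e]; ring
    cases d <;> simp only [Finset.mem_Icc] at h hs <;> first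
      | omega
      | simp only [eta, hz (by omega), zero_mul]

/-- The complementary classes: the grid stops one point earlier, and the factor vanishing at the
omitted point belongs to ϑ (N odd) or η* (N even), which blocks the step onto it. -/
theorem succ_mem_or_zero_of_even (hT : Truncated P N) {k : ℕ} (h : 2 * k ∈ gridIndices N d) :
    2 * k + 1 ∈ gridIndices N d ∨
      etaStar P d (-P.ρ₂ - k - 1) * theta P d (-P.ρ₂ - k - 1) = 0 := by
  by_cases hs : 2 * k + 1 ∈ gridIndices N d
  · exact Or.inl hs
  right
  obtain ⟨j, ⟨rfl, hP⟩ | ⟨rfl, hP⟩⟩ := hT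
  · rw [gridIndices_odd] at h hs
    have hz : j = k → -P.ρ₂ - k - 1 + P.r₂ + 1 / 2 = 0 := fun e => by rw [hP, e]; ring
    cases d <;> simp only [Finset.mem_Icc] at h hs <;> first
      | omega
      | simp only [theta, hz (by omega), mul_zero]
  · rw [gridIndices_even] at h hs
    have hz : j = k → -P.ρ₂ - k - 1 - P.ρ₁ = 0 := fun e => by rw [hP, e]; ring
    cases d <;> simp only [Finset.mem_Icc] at h hs <;> first
      | omega
      | simp only [etaStar, hz (by omega), zero_mul]

/-- `Ĥ` does not leave the grid through `x ↦ -x`. -/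
theorem neg_mem_grid_or (hT : Truncated P N) {x : ℝ} (h : x ∈ grid P N d) :
    -x ∈ grid P N d ∨ eta P d x * thetaStar P d x = 0 := by
  obtain ⟨k, ⟨hk, rfl⟩ | ⟨hk, rfl⟩⟩ := grid_cases h
  · rcases Nat.eq_zero_or_pos k with rfl | hk0
    · right
      rw [Nat.cast_zero, add_zero, eta_zero_of_mem hT hk, zero_mul]
    · left
      obtain ⟨i, rfl⟩ : ∃ i, k = i + 1 := ⟨k - 1, by omega⟩
      have := mem_grid_odd (P := P) (pred_mem_gridIndices hT hk)
      convert this using 1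
      push_cast; ring
  · refine (succ_mem_or_zero_of_odd hT hk).imp_left fun hs => ?_
    have := mem_grid_even (P := P) hs
    convert this using 1
    push_cast; ring

/-- `Ĥ` does not leave the grid through `x ↦ -x-1`. -/
theorem neg_sub_one_mem_grid_or (hT : Truncated P N) {x : ℝ} (h : x ∈ grid P N d) :
    -x - 1 ∈ grid P N d ∨ etaStar P d (-x - 1) * theta P d (-x - 1) = 0 := by
  obtain ⟨k, ⟨hk, rfl⟩ | ⟨hk, rfl⟩⟩ := grid_cases h
  · have e : -(P.ρ₂ + k) - 1 = -P.ρ₂ - k - 1 := by ring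
    rw [e]
    exact (succ_mem_or_zero_of_even hT hk).imp_left mem_grid_odd
  · have e : -(-P.ρ₂ - k - 1) - 1 = P.ρ₂ + k := by ring
    rw [e]
    rcases even_mem_or_etaStar_zero hT hk with hs | ⟨rfl, h0⟩
    · exact Or.inl (mem_grid_even hs)
    · right
      rw [Nat.cast_zero, add_zero, h0, zero_mul]

end Grid

/-! ### Finiteness and non-vanishing of the explicit weight -/

section Generic

variable {P : Params} {d : GaugeClass} {N : ℕ} {x : ℝ}

/-- `s` is not a pole of the Gamma function. -/
def GammaRegular (s : ℝ) : Prop := ∀ n : ℕ, s ≠ -n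

theorem NotInt.gammaRegular {s : ℝ} (h : NotInt s) : GammaRegular s := fun n => by
  simpa using h (-n)

theorem gammaRegular_of_pos {s : ℝ} (h : 0 < s) : GammaRegular s := fun n hn => by
  have : (0 : ℝ) ≤ n := Nat.cast_nonneg n
  linarith

theorem GammaRegular.continuousAt {f : ℝ → ℝ} (hf : Continuous f) (h : GammaRegular (f x)) :
    ContinuousAt (fun y => Real.Gamma (f y)) x :=
  ContinuousAt.comp (f := f) (Real.differentiableAt_Gamma h).continuousAt hf.continuousAt

theorem gammaNum_regular {r : ℝ} (h1 : GammaRegular (1 / 2 + r + x))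
    (h2 : GammaRegular (1 / 2 + r - x)) : ContinuousAt (gammaNum r) x ∧ gammaNum r x ≠ 0 :=
  ⟨(h1.continuousAt (f := fun y => 1 / 2 + r + y) (by fun_prop)).mul
    (h2.continuousAt (f := fun y => 1 / 2 + r - y) (by fun_prop)),
    mul_ne_zero (Real.Gamma_ne_zero h1) (Real.Gamma_ne_zero h2)⟩

theorem gammaDen_regular {ρ : ℝ} (h1 : GammaRegular (ρ - x))
    (h2 : GammaRegular (1 + ρ + x)) : ContinuousAt (gammaDen ρ) x ∧ gammaDen ρ x ≠ 0 :=
  ⟨(h1.continuousAt (f := fun y => ρ - y) (by fun_prop)).mul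
    (h2.continuousAt (f := fun y => 1 + ρ + y) (by fun_prop)),
    mul_ne_zero (Real.Gamma_ne_zero h1) (Real.Gamma_ne_zero h2)⟩

/-- Whether `x + r₂ + 1/2` is a factor of `ϑ*_d`. -/
def thetaStarHasR₂ : GaugeClass → Bool
  | .d2 | .d4 | .d6 | .d8 => true
  | _ => false

/-- At x_N, for N odd, Γ(1/2+r₂+x) has a pole. There ϑ* contains the factor s = x+r₂+1/2, and sΓ(s)
= Γ(s+1) is continuous and nonzero. K is this continuous representative of ϑ*Γ(1/2+r₂+x)Γ(1/2+r₂-x).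
-/
theorem exists_thetaStar_mul_gammaNum (h1 : x + P.r₁ + 1 / 2 ≠ 0)
    (hreg : thetaStarHasR₂ d = false → GammaRegular (1 / 2 + P.r₂ + x))
    (hreg' : GammaRegular (x + P.r₂ + 1 / 2 + 1))
    (hsub : GammaRegular (1 / 2 + P.r₂ - x)) :
    ∃ K : ℝ → ℝ, ContinuousAt K x ∧ K x ≠ 0 ∧
      ∀ y, IsRegular P y → thetaStar P d y * gammaNum P.r₂ y = K y := by
  by_cases hd : thetaStarHasR₂ d = false
  · obtain ⟨hc, hne⟩ := gammaNum_regular (hreg hd) hsub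
    refine ⟨fun y => thetaStar P d y * gammaNum P.r₂ y,
      (continuous_thetaStar P d).continuousAt.mul hc, mul_ne_zero ?_ hne, fun y _ => rfl⟩
    cases d <;> simp only [thetaStar, thetaStarHasR₂, ne_eq, one_ne_zero, not_false_eq_true,
      reduceCtorEq] at hd ⊢ <;> exact h1
  · obtain ⟨v, hv⟩ : ∃ v : ℝ[X], v.eval x ≠ 0 ∧
        ∀ y, thetaStar P d y = v.eval y * (y + P.r₂ + 1 / 2) := by
      cases d
      case d2 | d4 =>
        exact ⟨X + C P.r₁ + C (1 / 2), by simpa using h1, fun y => by simp [thetaStar]⟩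
      case d6 | d8 => exact ⟨1, by simp, fun y => by simp [thetaStar]⟩
      all_goals exact absurd rfl hd
    refine ⟨fun y => v.eval y * (Real.Gamma (y + P.r₂ + 1 / 2 + 1) *
      Real.Gamma (1 / 2 + P.r₂ - y)), ?_, ?_, fun y hy => ?_⟩
    · exact v.continuous.continuousAt.mul
        ((hreg'.continuousAt (f := fun y => y + P.r₂ + 1 / 2 + 1) (by fun_prop)).mul
          (hsub.continuousAt (f := fun y => 1 / 2 + P.r₂ - y) (by fun_prop)))
    · exact mul_ne_zero hv.1 (mul_ne_zero (Real.Gamma_ne_zero hreg') (Real.Gamma_ne_zero hsub))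
    · simp only [Real.Gamma_add_one hy.add_r₂.ne_zero]
      rw [hv.2, gammaNum, show 1 / 2 + P.r₂ + y = y + P.r₂ + 1 / 2 by ring]
      ring

/-- The factors of the weight at the grid points, for generic parameters. -/
structure IsGenericPoint (P : Params) (d : GaugeClass) (x : ℝ) : Prop where
  two_mul : NotInt (2 * x)
  add_r₁ : NotInt (x + P.r₁ + 1 / 2)
  sub_r₁ : NotInt (x - P.r₁ + 1 / 2)
  etaStar : etaStar P d x ≠ 0
  r₂_add : thetaStarHasR₂ d = false → GammaRegular (1 / 2 + P.r₂ + x)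
  r₂_add_one : GammaRegular (x + P.r₂ + 1 / 2 + 1)
  r₂_sub : GammaRegular (1 / 2 + P.r₂ - x)
  ρ₁_sub : GammaRegular (-P.ρ₁ - x)
  ρ₁_add : GammaRegular (1 + -P.ρ₁ + x)
  ρ₂_sub : GammaRegular (-P.ρ₂ - x)
  ρ₂_add : GammaRegular (1 + -P.ρ₂ + x)

/-- The exceptions are the classes whose η* lacks the factor in question. -/
theorem etaStar_ne_zero_of (h1 : x - P.ρ₁ ≠ 0 ∨ d = .d5 ∨ d = .d8 ∨ d = .d2 ∨ d = .d3)
    (h2 : x - P.ρ₂ ≠ 0 ∨ d = .d6 ∨ d = .d7 ∨ d = .d2 ∨ d = .d3) : etaStar P d x ≠ 0 := by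
  cases d <;> simp only [reduceCtorEq, or_false, or_true] at h1 h2 <;>
    simp [etaStar, h1, h2]

/-- Each argument either differs by an integer from plus or minus one of the numbers assumed
non-integral, or is an explicit integer fixed by ρ₂ and the truncation; in the latter case the index
bounds make it positive. -/
theorem isGenericPoint_of_mem (hT : Truncated P N) (hG : Generic P N) (h : x ∈ grid P N d) :
    IsGenericPoint P d x := by
  obtain ⟨hρ, hr1, hr1', hodd, heven⟩ := hG
  obtain ⟨k, ⟨hk, rfl⟩ | ⟨hk, rfl⟩⟩ := grid_cases h
  · have hk0 : (0 : ℝ) ≤ k := Nat.cast_nonneg k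
    have hρ₂ : P.ρ₂ + k - P.ρ₂ ≠ 0 ∨ d = .d6 ∨ d = .d7 ∨ d = .d2 ∨ d = .d3 := by
      by_cases hk1 : k = 0
      · right
        subst hk1
        obtain ⟨j, ⟨rfl, -⟩ | ⟨rfl, -⟩⟩ := hT
        · rw [gridIndices_odd] at hk
          cases d <;> simp at hk ⊢
        · rw [gridIndices_even] at hk
          cases d <;> simp at hk ⊢
      · left
        simpa using hk1
    obtain ⟨j, ⟨rfl, hP⟩ | ⟨rfl, hP⟩⟩ := hT
    · obtain ⟨ho, ho'⟩ := hodd ⟨j, rfl⟩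
      have hj : k ≤ j := by
        rw [gridIndices_odd] at hk
        cases d <;> simp only [Finset.mem_Icc] at hk <;> omega
      have hj' : (k : ℝ) ≤ j := by exact_mod_cast hj
      exact
        { two_mul := hρ.of_eq_add (2 * k) (by push_cast; ring)
          add_r₁ := hr1.of_eq_add k (by push_cast; ring)
          sub_r₁ := hr1'.of_eq_neg_add (k + 1) (by push_cast; ring)
          etaStar := etaStar_ne_zero_of
            (Or.inl (ho'.of_eq_neg_add k (by push_cast; ring)).ne_zero) hρ₂
          r₂_add := fun _ => (hρ.of_eq_add (j + 1 + k) (by rw [hP]; push_cast; ring)).gammaRegular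
          r₂_add_one := (hρ.of_eq_add (j + 2 + k) (by rw [hP]; push_cast; ring)).gammaRegular
          r₂_sub := gammaRegular_of_pos (by rw [hP]; linarith)
          ρ₁_sub := (ho.of_eq_neg_add (-k) (by push_cast; ring)).gammaRegular
          ρ₁_add := (ho'.of_eq_neg_add (1 + k) (by push_cast; ring)).gammaRegular
          ρ₂_sub := (hρ.of_eq_neg_add (-k) (by push_cast; ring)).gammaRegular
          ρ₂_add := gammaRegular_of_pos (by linarith) }
    · obtain ⟨ho, ho'⟩ := heven ⟨j + 1, by ring⟩
      have hj : k ≤ j := by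
        rw [gridIndices_even] at hk
        cases d <;> simp only [Finset.mem_Icc] at hk <;> omega
      have hj' : (k : ℝ) ≤ j := by exact_mod_cast hj
      exact
        { two_mul := hρ.of_eq_add (2 * k) (by push_cast; ring)
          add_r₁ := hr1.of_eq_add k (by push_cast; ring)
          sub_r₁ := hr1'.of_eq_neg_add (k + 1) (by push_cast; ring)
          etaStar := etaStar_ne_zero_of
            (Or.inl (hρ.of_eq_add (k + j + 1) (by rw [hP]; push_cast; ring)).ne_zero) hρ₂
          r₂_add := fun _ => (ho.of_eq_add k (by push_cast; ring)).gammaRegular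
          r₂_add_one := (ho.of_eq_add (k + 1) (by push_cast; ring)).gammaRegular
          r₂_sub := (ho'.of_eq_add (-k) (by push_cast; ring)).gammaRegular
          ρ₁_sub := gammaRegular_of_pos (by rw [hP]; linarith)
          ρ₁_add := (hρ.of_eq_add (j + 2 + k) (by rw [hP]; push_cast; ring)).gammaRegular
          ρ₂_sub := (hρ.of_eq_neg_add (-k) (by push_cast; ring)).gammaRegular
          ρ₂_add := gammaRegular_of_pos (by linarith) }
  · have hk0 : (0 : ℝ) ≤ k := Nat.cast_nonneg k
    have hρ₂ : -P.ρ₂ - k - 1 - P.ρ₂ ≠ 0 ∨ d = .d6 ∨ d = .d7 ∨ d = .d2 ∨ d = .d3 :=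
      Or.inl (hρ.of_eq_neg_add (-k - 1) (by push_cast; ring)).ne_zero
    obtain ⟨j, ⟨rfl, hP⟩ | ⟨rfl, hP⟩⟩ := hT
    · obtain ⟨ho, ho'⟩ := hodd ⟨j, rfl⟩
      rw [gridIndices_odd] at hk
      have hj : k ≤ j := by
        cases d <;> simp only [Finset.mem_Icc] at hk <;> omega
      -- Here 1/2+r₂+x = j-k. Without the factor in ϑ* the grid stops before x_N, so this is
      -- positive.
      have hlt : thetaStarHasR₂ d = false → k + 1 ≤ j := fun hd => by
        cases d <;> simp only [thetaStarHasR₂, reduceCtorEq, Finset.mem_Icc] at hk hd <;> omega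
      have hj' : (k : ℝ) ≤ j := by exact_mod_cast hj
      exact
        { two_mul := hρ.of_eq_neg_add (-2 * k - 2) (by push_cast; ring)
          add_r₁ := hr1'.of_eq_add (-k - 1) (by push_cast; ring)
          sub_r₁ := hr1.of_eq_neg_add (-k) (by push_cast; ring)
          etaStar := etaStar_ne_zero_of
            (Or.inl (ho.of_eq_neg_add (-k - 1) (by push_cast; ring)).ne_zero) hρ₂
          r₂_add := fun hd => gammaRegular_of_pos (by
            have : ((k + 1 : ℕ) : ℝ) ≤ j := by exact_mod_cast hlt hd
            push_cast at this
            rw [hP]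
            linarith)
          r₂_add_one := gammaRegular_of_pos (by rw [hP]; linarith)
          r₂_sub := (hρ.of_eq_add (j + 2 + k) (by rw [hP]; push_cast; ring)).gammaRegular
          ρ₁_sub := (ho'.of_eq_neg_add (1 + k) (by push_cast; ring)).gammaRegular
          ρ₁_add := (ho.of_eq_neg_add (-k) (by push_cast; ring)).gammaRegular
          ρ₂_sub := gammaRegular_of_pos (by linarith)
          ρ₂_add := (hρ.of_eq_neg_add (-k) (by push_cast; ring)).gammaRegular }
    · obtain ⟨ho, ho'⟩ := heven ⟨j + 1, by ring⟩
      rw [gridIndices_even] at hk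
      have hj : k ≤ j := by
        cases d <;> simp only [Finset.mem_Icc] at hk <;> omega
      have hj' : (k : ℝ) ≤ j := by exact_mod_cast hj
      -- The point with k = j is ρ₁; it belongs to the grid only when η* lacks the factor x-ρ₁.
      have hρ₁ : -P.ρ₂ - k - 1 - P.ρ₁ ≠ 0 ∨ d = .d5 ∨ d = .d8 ∨ d = .d2 ∨ d = .d3 := by
        by_cases hkj : k = j
        · right
          cases d <;> simp only [Finset.mem_Icc] at hk <;> first | omega | simp
        · left
          rw [hP]
          intro h0
          exact hkj (by exact_mod_cast (show (k : ℝ) = j by linarith))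
      exact
        { two_mul := hρ.of_eq_neg_add (-2 * k - 2) (by push_cast; ring)
          add_r₁ := hr1'.of_eq_add (-k - 1) (by push_cast; ring)
          sub_r₁ := hr1.of_eq_neg_add (-k) (by push_cast; ring)
          etaStar := etaStar_ne_zero_of hρ₁ hρ₂
          r₂_add := fun _ => (ho'.of_eq_add (-k - 1) (by push_cast; ring)).gammaRegular
          r₂_add_one := (ho'.of_eq_add (-k) (by push_cast; ring)).gammaRegular
          r₂_sub := (ho.of_eq_add (k + 1) (by push_cast; ring)).gammaRegular
          ρ₁_sub := (hρ.of_eq_add (j + 2 + k) (by rw [hP]; push_cast; ring)).gammaRegular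
          ρ₁_add := gammaRegular_of_pos (by rw [hP]; linarith)
          ρ₂_sub := gammaRegular_of_pos (by linarith)
          ρ₂_add := (hρ.of_eq_neg_add (-k) (by push_cast; ring)).gammaRegular }

theorem sin_two_pi_mul_ne_zero (h : NotInt (2 * x)) : Real.sin (2 * Real.pi * x) ≠ 0 := by
  rw [Real.sin_ne_zero_iff]
  intro n hn
  refine h n ?_
  have := Real.pi_ne_zero
  refine mul_left_cancel₀ this ?_
  linarith

theorem exists_tendsto_xbiWeight {m : ℕ} {a t : ℝ[X]}
    (hq : IsSeedQuotient P d (seedPoly P d m) (fun x => a.eval x) (fun x => t.eval x))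
    (ha : a.eval x ≠ 0) (ht : t.eval x ≠ 0) (h : IsGenericPoint P d x) :
    ∃ b : ℝ, b ≠ 0 ∧
      Tendsto (xbiWeight P d m (fun _ => 1) (biWeight P)) (𝓝[≠] x) (𝓝 b) := by
  have ha0 : a ≠ 0 := fun h => ha (by simp [h])
  have ht0 : t ≠ 0 := fun h => ht (by simp [h])
  obtain ⟨K, hK, hK0, hKy⟩ := exists_thetaStar_mul_gammaNum h.add_r₁.ne_zero h.r₂_add
    h.r₂_add_one h.r₂_sub
  obtain ⟨hg, hg0⟩ := gammaNum_regular (r := -P.r₁) (x := x)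
    (h.sub_r₁.of_eq_add 0 (by push_cast; ring)).gammaRegular
    (h.add_r₁.of_eq_neg_add 1 (by push_cast; ring)).gammaRegular
  obtain ⟨hk, hk0⟩ := gammaDen_regular h.ρ₁_sub h.ρ₁_add
  obtain ⟨hl, hl0⟩ := gammaDen_regular h.ρ₂_sub h.ρ₂_add
  have hs0 := sin_two_pi_mul_ne_zero h.two_mul
  have hs : ContinuousAt (fun y => Real.sin (2 * Real.pi * y)) x := by fun_prop
  have hden0 : K x * gammaDen (-P.ρ₁) x * gammaDen (-P.ρ₂) x * (2 * (a.eval x * t.eval x)) ≠ 0 :=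
    mul_ne_zero (mul_ne_zero (mul_ne_zero hK0 hk0) hl0)
      (mul_ne_zero two_ne_zero (mul_ne_zero ha ht))
  have hc : ContinuousAt (fun y => etaStar P d y *
      (Real.sin (2 * Real.pi * y) * gammaNum (-P.r₁) y) /
      (K y * gammaDen (-P.ρ₁) y * gammaDen (-P.ρ₂) y * (2 * (a.eval y * t.eval y)))) x :=
    ((continuous_etaStar P d).continuousAt.mul (hs.mul hg)).div
      (((hK.mul hk).mul hl).mul
        (continuousAt_const.mul (a.continuous.mul t.continuous).continuousAt)) hden0
  refine ⟨_, div_ne_zero (mul_ne_zero h.etaStar (mul_ne_zero hs0 hg0)) hden0,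
    (hc.tendsto.mono_left nhdsWithin_le_nhds).congr' ?_⟩
  filter_upwards [eventually_isRegular P x, eventually_eval_ne_zero ha0 x,
    eventually_eval_ne_zero ht0 x] with y h1 h2 h3
  rw [xbiWeight_eq hq h1 h2 h3, biWeight_eq, ← hKy y h1]
  simp only [div_eq_mul_inv, mul_inv]
  ring

end Generic

/-! ### Passage of the weight relations to the grid -/

section Weight

variable {x : ℝ}

/-- The limits of a function at `x` and at `σ x` agree if the function is `σ`-invariant at all but
countably many points near `x`. -/
theorem limit_eq_of_involution {σ : ℝ → ℝ} (hσ : ∀ x, σ (σ x) = x) (hσc : Continuous σ)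
    {F : ℝ → ℝ} {C : Set ℝ} (hC : C.Countable) {u v : ℝ} (hu : Tendsto F (𝓝[≠] x) (𝓝 u))
    (hv : Tendsto F (𝓝[≠] (σ x)) (𝓝 v))
    (h : ∀ᶠ y in 𝓝[≠] x, y ∉ C → F y = F (σ y)) : u = v := by
  have hmap : Tendsto σ (𝓝[≠] x) (𝓝[≠] (σ x)) := by
    refine tendsto_nhdsWithin_of_tendsto_nhds_of_eventually_within _
      (hσc.continuousAt.tendsto.mono_left nhdsWithin_le_nhds) ?_
    filter_upwards [self_mem_nhdsWithin] with y hy h0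
    exact hy (by rw [Set.mem_singleton_iff, ← hσ y, h0, hσ])
  -- A countable set has dense complement, so x can be approached within it and the limit along it
  -- is unique.
  have hd : Dense (C ∪ {x})ᶜ := (hC.union (Set.countable_singleton x)).dense_compl ℝ
  have hne : (𝓝[(C ∪ {x})ᶜ] x).NeBot := mem_closure_iff_nhdsWithin_neBot.mp (hd x)
  have hle : 𝓝[(C ∪ {x})ᶜ] x ≤ 𝓝[≠] x :=
    nhdsWithin_mono x fun y hy hyx => hy (Or.inr hyx)
  refine tendsto_nhds_unique_of_eventuallyEq (l := 𝓝[(C ∪ {x})ᶜ] x) (hu.mono_left hle)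
    ((hv.comp hmap).mono_left hle) ?_
  filter_upwards [hle h, self_mem_nhdsWithin] with y hy hyC
  exact hy fun hc => hyC (Or.inl hc)

end Weight

/-! ### Weight relations and orthogonality on the grid -/

section Grid

variable {P : Params} {d : GaugeClass} {m N : ℕ} {a t : ℝ[X]}

/-- The values of the polynomial quotients at a point where `χ` and `χ̃` do not degenerate. -/
theorem quotient_ne_zero {p a t : ℝ → ℝ} (hq : IsSeedQuotient P d p a t) {x : ℝ}
    (hchi : eta P d x * p x ≠ eta P d (-x) * p (-x))
    (hchiTilde : theta P d x * p x ≠ theta P d (-x - 1) * p (-x - 1)) :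
    (x ≠ 0 ∧ a x ≠ 0) ∧ 2 * x + 1 ≠ 0 ∧ t x ≠ 0 :=
  ⟨mul_ne_zero_iff.mp (hq.a_eq x ▸ sub_ne_zero.mpr hchi),
    mul_ne_zero_iff.mp (hq.t_eq x ▸ sub_ne_zero.mpr hchiTilde)⟩

/-- Near a grid point both sides of each relation agree wherever the relation of ω holds, and each
side converges, to the weight's limit times the coefficient's. The relation holds at the grid point
by `limit_eq_of_involution`. -/
theorem isWeightOn_of_tendsto
    (hq : IsSeedQuotient P d (seedPoly P d m) (fun x => a.eval x) (fun x => t.eval x))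
    {S : Set ℝ} (hS : ∀ x ∈ S, (x ≠ 0 ∧ a.eval x ≠ 0) ∧ 2 * x + 1 ≠ 0 ∧ t.eval x ≠ 0)
    {ω c w : ℝ → ℝ} (hω : IsBannaiItoWeight P ω) (hc1 : ∀ x, c (x + 1) = c x)
    (hc : ∀ x, c (-x) = c x)
    (hw : ∀ x ∈ S, Tendsto (xbiWeight P d m c ω) (𝓝[≠] x) (𝓝 (w x))) :
    IsWeightOn S (alphaHat P d m) (betaHat P d m) w := by
  obtain ⟨C, hC, hα, hβ⟩ := hω
  have hc' : ∀ x, c (-x - 1) = c x := fun x => by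
    rw [← hc1 (-x - 1), sub_add_cancel, hc]
  constructor
  · intro x hx hx'
    obtain ⟨⟨h0, ha⟩, h2, ht⟩ := hS x hx
    obtain ⟨⟨h0', ha'⟩, h2', ht'⟩ := hS (-x) hx'
    have ha0 : a ≠ 0 := fun h => ha (by simp [h])
    have ht0 : t ≠ 0 := fun h => ht (by simp [h])
    rw [alphaHat_eq hq h0 ha ht0, alphaHat_eq hq h0' ha' ht0]
    refine limit_eq_of_involution (σ := fun x => -x) neg_neg continuous_neg
      -- The relation for ω requires both y and -y to avoid its exceptional set.
      (hC.union (hC.preimage neg_injective)) ((hw x hx).mul (tendsto_alphaHat hq h0 ha ht0))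
      ((hw (-x) hx').mul (tendsto_alphaHat hq h0' ha' ht0)) ?_
    filter_upwards [eventually_isRegular P x, eventually_eval_ne_zero ha0 x,
      eventually_eval_ne_zero ht0 x, eventually_eval_neg_ne_zero ht0 x] with y h3 h4 h5 h6 hy
    rw [Set.mem_union, not_or] at hy
    exact xbiWeight_mul_neg hq h3 h4 h5 h6 (hc y) (hα y hy.1 hy.2)
  · intro x hx hx'
    obtain ⟨⟨h0, ha⟩, h2, ht⟩ := hS x hx
    obtain ⟨⟨h0', ha'⟩, h2', ht'⟩ := hS (-x - 1) hx'
    have ha0 : a ≠ 0 := fun h => ha (by simp [h])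
    have ht0 : t ≠ 0 := fun h => ht (by simp [h])
    rw [betaHat_eq hq h2 ha0 ht, betaHat_eq hq h2' ha0 ht']
    refine limit_eq_of_involution (σ := fun x => -x - 1) (fun x => by ring) (by fun_prop)
      (hC.union (hC.preimage (f := fun x => -x - 1) fun u v h => by simpa using h))
      ((hw x hx).mul (tendsto_betaHat hq h2 ha0 ht))
      ((hw (-x - 1) hx').mul (tendsto_betaHat hq h2' ha0 ht')) ?_
    filter_upwards [eventually_isRegular P x, eventually_eval_ne_zero ha0 x,
      eventually_eval_ne_zero ht0 x, eventually_eval_neg_sub_one_ne_zero ha0 x]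
      with y h3 h4 h5 h6 hy
    rw [Set.mem_union, not_or] at hy
    exact xbiWeight_mul_neg_sub_one hq h3 h4 h6 h5 (hc' y) (hβ y hy.1 hy.2)

/-- Exceptional polynomials to different eigenvalues are orthogonal on the grid. -/
theorem sum_xbi_eq_zero (hT : Truncated P N)
    (hp : IsBannaiIto (sigma P d) m (bannaiIto (sigma P d) m))
    (hq : IsSeedQuotient P d (seedPoly P d m) (fun x => a.eval x) (fun x => t.eval x))
    (hS : ∀ x ∈ grid P N d, (x ≠ 0 ∧ a.eval x ≠ 0) ∧ 2 * x + 1 ≠ 0 ∧ t.eval x ≠ 0)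
    {w : ℝ → ℝ} (hw : IsWeightOn (grid P N d) (alphaHat P d m) (betaHat P d m) w) {n k : ℕ}
    (hn : IsBannaiIto P n (bannaiIto P n)) (hk : IsBannaiIto P k (bannaiIto P k))
    (hnk : eigenvalue P n ≠ eigenvalue P k) :
    ∑ x ∈ grid P N d, w x * (xbi P d m n).eval x * (xbi P d m k).eval x = 0 := by
  -- The grid may be empty, as for N = 1 and `d1`. Otherwise any of its points shows that a and t
  -- are nonzero polynomials.
  rcases (grid P N d).eq_empty_or_nonempty with hemp | ⟨x₀, hx₀⟩
  · simp [hemp]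
  have ha0 : a ≠ 0 := fun h => (hS x₀ hx₀).1.2 (by simp [h])
  have ht0 : t ≠ 0 := fun h => (hS x₀ hx₀).2.2 (by simp [h])
  obtain ⟨κ, hκ⟩ := exists_seed_eigen P d m hp hq
  have heig : ∀ i, IsBannaiIto P i (bannaiIto P i) → ∀ x ∈ grid P N d,
      alphaHat P d m x * (xbi P d m i).eval (-x) + betaHat P d m x * (xbi P d m i).eval (-x - 1) -
        (-(eta P d x * thetaStar P d x * t.eval x) / (x * a.eval x) +
          theta P d x * etaStar P d x * a.eval x / (2 * (2 * x + 1) * t.eval x)) *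
          (xbi P d m i).eval x =
        (eigenvalue P i - (κ + P.r₁ + P.r₂)) * (xbi P d m i).eval x := by
    intro i hi x hx
    obtain ⟨⟨h0, ha⟩, h2, ht⟩ := hS x hx
    obtain ⟨D, S, hd⟩ := exists_isDressQuotient P (bannaiIto P i)
    rw [alphaHat_eq hq h0 ha ht0, betaHat_eq hq h2 ha0 ht]
    exact exceptional_eigen hq hd hκ (hd.eigen hi) (xbi_eval hq ha0 ht0 hd) h0 h2 ha ht
  refine sum_weight_eq_zero hw ?_ ?_ (heig n hn) (heig k hk) (fun h => hnk (sub_left_injective h))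
  · intro x hx
    obtain ⟨⟨h0, ha⟩, h2, ht⟩ := hS x hx
    refine (neg_mem_grid_or hT hx).imp_right fun h => ?_
    rw [alphaHat_eq hq h0 ha ht0, h]
    simp
  · intro x hx
    obtain ⟨⟨h0, ha⟩, h2, ht⟩ := hS x hx
    refine (neg_sub_one_mem_grid_or hT hx).imp_right fun h => ?_
    rw [betaHat_eq hq h2 ha0 ht, mul_assoc (a.eval x), h]
    simp

end Grid

end ExcBI

theorem theorem4p11 (P : Params) (d : GaugeClass) (m N : ℕ) (hN : 0 < N)
    -- the truncation condition
    (htrunc : (Odd N ∧ P.r₂ = P.ρ₂ + (N : ℝ) / 2) ∨ (Even N ∧ P.ρ₁ = -P.ρ₂ - (N : ℝ) / 2))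
    -- the eigenvalues of `B_0, …, B_{N-1}` are distinct
    (heig : ∀ n < N, ∀ k < N, n ≠ k → eigenvalue P n ≠ eigenvalue P k)
    -- the polynomial part `B_m(x; σ_d)` of the seed solution exists and is unique
    (hseed : ∀ k < m, eigenvalue (sigma P d) k ≠ eigenvalue (sigma P d) m)
    -- the normalized functions `χ` and `χ̃` of the seed solution do not vanish on the grid
    (hchi : ∀ x ∈ grid P N d,
      eta P d x * seedPoly P d m x ≠ eta P d (-x) * seedPoly P d m (-x))
    (hchiTilde : ∀ x ∈ grid P N d,
      theta P d x * seedPoly P d m x ≠ theta P d (-x - 1) * seedPoly P d m (-x - 1)) :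
    -- orthogonality with respect to every weight function associated with `Ĥ^{(1)}`
    (∀ w : ℝ → ℝ, IsWeightOn (grid P N d) (alphaHat P d m) (betaHat P d m) w →
      ∃ h : ℕ → ℝ, ∀ n < N, ∀ k < N,
        ∑ x ∈ grid P N d, w x * (xbi P d m n).eval x * (xbi P d m k).eval x =
          if n = k then h n else 0) ∧
    -- `c χ̃ χ α ω / r²` is such a weight function
    (∀ ω c w : ℝ → ℝ, IsBannaiItoWeight P ω → (∀ x, c (x + 1) = c x) → (∀ x, c (-x) = c x) →
      (∀ x ∈ grid P N d, Tendsto (xbiWeight P d m c ω) (𝓝[≠] x) (𝓝 (w x))) →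
      IsWeightOn (grid P N d) (alphaHat P d m) (betaHat P d m) w) ∧
    -- for generic parameters it is finite and nowhere zero on the grid, for an explicit `ω`
    (Generic P N → IsBannaiItoWeight P (biWeight P) ∧
      ∀ x ∈ grid P N d, ∃ a : ℝ, a ≠ 0 ∧
        Tendsto (xbiWeight P d m (fun _ => 1) (biWeight P)) (𝓝[≠] x) (𝓝 a)) := by
  have hT := truncated_of hN htrunc
  have hp := isBannaiIto_bannaiIto (sigma P d) m hseed
  obtain ⟨a, t, hq⟩ : ∃ a t : ℝ[X], IsSeedQuotient P d (seedPoly P d m) (fun x => a.eval x)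
    (fun x => t.eval x) := exists_isSeedQuotient P d (bannaiIto (sigma P d) m)
  have hS : ∀ x ∈ grid P N d, (x ≠ 0 ∧ a.eval x ≠ 0) ∧ 2 * x + 1 ≠ 0 ∧ t.eval x ≠ 0 :=
    fun x hx => quotient_ne_zero hq (hchi x hx) (hchiTilde x hx)
  have hB : ∀ n < N, IsBannaiIto P n (bannaiIto P n) := fun n hn =>
    isBannaiIto_bannaiIto P n fun k hk => heig k (hk.trans hn) n hn hk.ne
  refine ⟨fun w hw => ?_, fun ω c w hω hc1 hc hw => isWeightOn_of_tendsto hq hS hω hc1 hc hw,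
    fun hG => ⟨isBannaiItoWeight_biWeight P, fun x hx =>
      exists_tendsto_xbiWeight hq (hS x hx).1.2 (hS x hx).2.2 (isGenericPoint_of_mem hT hG hx)⟩⟩
  refine ⟨fun n => ∑ x ∈ grid P N d, w x * (xbi P d m n).eval x * (xbi P d m n).eval x,
    fun n hn k hk => ?_⟩
  split_ifs with hnk
  · rw [hnk]
  · exact sum_xbi_eq_zero hT hp hq hS hw (hB n hn) (hB k hk) (heig n hn k hk hnk)
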